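/- For a finite group $G$ let $\mathcal R_{\mathbb Q}(G)$ be the Grothendieck group of the category of finitely generated $\mathbb QG$-modules and let $\mathcal R_{\mathbb Q}^*(G)=\mathrm{Hom}_{\mathbb Z}(\mathcal R_{\mathbb Q}(G),\mathbb Z)$. For $H\le G$ write $W_G(H)=N_G(H)/H$, and let $\mathrm{des}^G_{W_G(H)}:\mathcal R_{\mathbb Q}^*(G)\to \mathcal R_{\mathbb Q}^*(W_G(H))$ be the transpose of inflation from $W_G(H)$ to $N_G(H)$ followed by induction to $G$. For $H\trianglelefteq K\le G$ and $N_G(H,K)=N_G(H)\cap N_G(K)$ one has in the same way $\mathrm{des}^{W_G(H)}_{N_G(H,K)/K}$, and the restriction $\mathrm{res}^{W_G(K)}_{N_G(H,K)/K}$, the transpose of induction. Let $\varprojlim_{1<H\le G}\mathcal R_{\mathbb Q}^*(W_G(H))$ be the group of gluing data: the families $(f_H)_{1<H\le G}$ with $f_H\in\mathcal R_{\mathbb Q}^*(W_G(H))$ such that ${}^gf_H=f_{{}^gH}$ for all $g\in G$, and $\mathrm{des}^{W_G(H)}_{N_G(H,K)/K}f_H=\mathrm{res}^{W_G(K)}_{N_G(H,K)/K}f_K$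 whenever $1<H\trianglelefteq K$. Put $r_G(f)=(\mathrm{des}^G_{W_G(H)}f)_{1<H\le G}$. Let $B^*(G)$ be the group of super class functions on $G$ (functions from the set of subgroups of $G$ to $\mathbb Z$ that are constant on conjugacy classes), with $\mathrm{des}^G_{W_G(H)}:B^*(G)\to B^*(W_G(H))$, $(\mathrm{des}\,f)(L/H)=f(L)$, and let $\mathrm{lin}^*_G:\mathcal R_{\mathbb Q}^*(G)\to B^*(G)$, $\varphi\mapsto (H\mapsto\varphi([\mathbb Q[G/H]]))$, be the transpose of the linearization map. Let $p$ be a prime and let $P$ be a finite $p$-group of rank $1$ (the largest elementary abelian subgroups of $P$ have order $p$). Then: (1) There is an exact sequence of abelian groups $$0\to\mathbb Z\to\mathcal R_{\mathbb Q}^*(P)\xrightarrow{\;r_P\;}\varprojlim_{1<Q\le P}\mathcal R_{\mathbb Q}^*(N_P(Q)/Q)\to 0 .$$ In particular, the gluing problem for $\mathcal R_{\mathbb Q}^*$ at $P$ always has a solution. (2) A super class function $f\in B^*(P)$ lies in the image of $\mathrm{lin}^*_P$ if and only if $\mathrm{des}^P_{N_P(Q)/Q}f$ lies in the image of $\mathrm{lin}^*_{N_P(Q)/Q}$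 for every $1<Q\le P$. (3) If $P$ is cyclic, then $\mathcal R_{\mathbb Q}^*=B^*$ on $P$ and on its subquotients $N_P(Q)/Q$, $1<Q\le P$; that is, $\mathrm{lin}^*_P$ and all $\mathrm{lin}^*_{N_P(Q)/Q}$ are isomorphisms. -/

import Mathlib

universe u

namespace RatGluing

open CategoryTheory

noncomputable section

section RationalRepresentations

/-- Finite-dimensional representations over `ℚ` (that is, finitely generated `ℚG`-modules). -/
abbrev FinRep (G : Type u) [Group G] : Type (u + 1) :=
  {V : Rep.{u} ℚ G // Module.Finite ℚ V}

/-- The relations of the Grothendieck group: `[V₂] - [V₁] - [V₃]` for every short exact sequence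
`0 → V₁ → V₂ → V₃ → 0` of finitely generated `ℚG`-modules. -/
def grothendieckRel (G : Type u) [Group G] : Set (FreeAbelianGroup (FinRep G)) :=
  {x | ∃ (S : ShortComplex (Rep.{u} ℚ G)) (h₁ : Module.Finite ℚ S.X₁)
      (h₂ : Module.Finite ℚ S.X₂) (h₃ : Module.Finite ℚ S.X₃), S.ShortExact ∧
      x = FreeAbelianGroup.of (⟨S.X₂, h₂⟩ : FinRep G) - FreeAbelianGroup.of ⟨S.X₁, h₁⟩
        - FreeAbelianGroup.of ⟨S.X₃, h₃⟩}

/-- `R_ℚ(G)`, the Grothendieck group of the category of finitely generated `ℚG`-modules. -/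
def RQ (G : Type u) [Group G] : Type (u + 1) :=
  FreeAbelianGroup (FinRep G) ⧸ AddSubgroup.closure (grothendieckRel G)

instance (G : Type u) [Group G] : AddCommGroup (RQ G) :=
  inferInstanceAs (AddCommGroup (_ ⧸ AddSubgroup.closure (grothendieckRel G)))

/-- The class `[V]` in `R_ℚ(G)`. -/
def RQ.mk {G : Type u} [Group G] (V : Rep.{u} ℚ G) (hV : Module.Finite ℚ V) : RQ G :=
  QuotientAddGroup.mk (FreeAbelianGroup.of (⟨V, hV⟩ : FinRep G))

theorem RQ.mk_shortExact {G : Type u} [Group G] (S : ShortComplex (Rep.{u} ℚ G))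
    (hS : S.ShortExact) (h₁ : Module.Finite ℚ S.X₁) (h₂ : Module.Finite ℚ S.X₂)
    (h₃ : Module.Finite ℚ S.X₃) : RQ.mk S.X₂ h₂ = RQ.mk S.X₁ h₁ + RQ.mk S.X₃ h₃ := by
  have h : (QuotientAddGroup.mk (FreeAbelianGroup.of (⟨S.X₂, h₂⟩ : FinRep G)
      - FreeAbelianGroup.of ⟨S.X₁, h₁⟩ - FreeAbelianGroup.of ⟨S.X₃, h₃⟩) : RQ G) = 0 :=
    (QuotientAddGroup.eq_zero_iff _).2
      (AddSubgroup.subset_closure ⟨S, h₁, h₂, h₃, hS, rfl⟩)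
  have h' : RQ.mk S.X₂ h₂ - RQ.mk S.X₁ h₁ - RQ.mk S.X₃ h₃ = 0 := h
  rw [sub_sub, sub_eq_zero] at h'
  exact h'

/-- An additive invariant of finite-dimensional representations extends to `R_ℚ(G)`. -/
def RQ.lift {G : Type u} [Group G] {A : Type*} [AddCommGroup A] (F : FinRep G → A)
    (hF : ∀ (S : ShortComplex (Rep.{u} ℚ G)) (h₁ : Module.Finite ℚ S.X₁)
      (h₂ : Module.Finite ℚ S.X₂) (h₃ : Module.Finite ℚ S.X₃), S.ShortExact →
      F ⟨S.X₂, h₂⟩ = F ⟨S.X₁, h₁⟩ + F ⟨S.X₃, h₃⟩) : RQ G →+ A :=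
  QuotientAddGroup.lift _ (FreeAbelianGroup.lift F) <| by
    rw [AddSubgroup.closure_le]
    rintro x ⟨S, h₁, h₂, h₃, hS, rfl⟩
    change FreeAbelianGroup.lift F (_ - _ - _) = 0
    rw [map_sub, map_sub, FreeAbelianGroup.lift_apply_of, FreeAbelianGroup.lift_apply_of,
      FreeAbelianGroup.lift_apply_of, hF S h₁ h₂ h₃ hS]
    abel

theorem RQ.lift_mk {G : Type u} [Group G] {A : Type*} [AddCommGroup A] (F : FinRep G → A)
    (hF) (V : Rep.{u} ℚ G) (hV : Module.Finite ℚ V) :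
    RQ.lift F hF (RQ.mk V hV) = F ⟨V, hV⟩ :=
  FreeAbelianGroup.lift_apply_of F _

/-- Isomorphic representations have the same class. -/
theorem RQ.mk_eq_of_iso {G : Type u} [Group G] {V W : Rep.{u} ℚ G} (e : V ≅ W)
    (hV : Module.Finite ℚ V) (hW : Module.Finite ℚ W) : RQ.mk V hV = RQ.mk W hW := by
  let Z : Rep.{u} ℚ G := Rep.trivial ℚ G PUnit.{u + 1}
  have hZ : Limits.IsZero Z := (Rep.isZero_iff (k := ℚ) (M := Z) (G := G)).2 (inferInstanceAs (Subsingleton PUnit.{u + 1}))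
  have hZf : Module.Finite ℚ Z := inferInstanceAs (Module.Finite ℚ PUnit.{u + 1})
  have key : ∀ {U : Rep.{u} ℚ G} (f : U ≅ W) (hU : Module.Finite ℚ U),
      RQ.mk W hW = RQ.mk U hU + RQ.mk Z hZf := fun {U} f hU => by
    refine RQ.mk_shortExact (ShortComplex.mk f.hom (0 : W ⟶ Z) (by simp)) ?_ hU hW hZf
    exact (ShortComplex.Splitting.ofIsIsoOfIsZero _ inferInstance hZ).shortExact
  exact add_right_cancel ((key e hV).symm.trans (key (Iso.refl W) hW))

/-- Pulling back along a group homomorphism `φ : G → H`: restriction if `φ` is injective,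
inflation if `φ` is surjective, transport of structure if `φ` is bijective. -/
def RQ.res {G H : Type u} [Group G] [Group H] (φ : G →* H) : RQ H →+ RQ G :=
  RQ.lift (fun V => RQ.mk (Rep.res φ V.1) V.2) fun S h₁ h₂ h₃ hS =>
    RQ.mk_shortExact (S.map (Rep.resFunctor φ)) ((Rep.shortExact_res φ).2 hS) h₁ h₂ h₃

theorem finite_ind {G H : Type u} [Group G] [Group H] [Finite H] (φ : G →* H)
    (V : Rep.{u} ℚ G) (hV : Module.Finite ℚ V) : Module.Finite ℚ (Rep.ind φ V) := by
  have : Module.Finite ℚ (MonoidAlgebra ℚ H) := inferInstance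
  exact inferInstanceAs (Module.Finite ℚ (Representation.IndV φ V.ρ))

theorem shortExact_ind {G H : Type u} [Group G] [Group H] [Finite G] (φ : G →* H)
    {S : ShortComplex (Rep.{u} ℚ G)} (hS : S.ShortExact) :
    ∃ h, (⟨Rep.indMap φ S.f, Rep.indMap φ S.g, h⟩ : ShortComplex (Rep.{u} ℚ H)).ShortExact := by
  have : (Rep.indFunctor.{u} ℚ φ).Additive := ⟨by
    intro X Y f g
    refine Rep.hom_ext (Representation.IntertwiningMap.ext
      (Representation.IndV.hom_ext _ _ fun h => LinearMap.ext fun a => ?_))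
    exact congrArg (Representation.Coinvariants.mk _)
      (TensorProduct.tmul_add (MonoidAlgebra.single h (1 : ℚ)) (f.hom a) (g.hom a))⟩
  have : NeZero (Nat.card G : ℚ) := ⟨by exact_mod_cast Nat.card_pos.ne'⟩
  have : Projective S.X₃ := by
    rw [← Rep.equivalenceModuleMonoidAlgebra.map_projective_iff, ← IsProjective.iff_projective]
    exact Module.projective_of_isSemisimpleRing _ _
  exact ⟨_, (hS.splittingOfProjective.map (Rep.indFunctor.{u} ℚ φ)).shortExact⟩

/-- Induction `V ↦ ℚH ⊗_{ℚG} V` along a homomorphism `φ : G → H` of finite groups. It is only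
used for injective `φ`. -/
def RQ.ind {G H : Type u} [Group G] [Group H] [Finite G] [Finite H] (φ : G →* H) : RQ G →+ RQ H :=
  RQ.lift (fun V => RQ.mk (Rep.ind φ V.1) (finite_ind φ V.1 V.2)) fun S h₁ h₂ h₃ hS =>
    RQ.mk_shortExact ⟨Rep.indMap φ S.f, Rep.indMap φ S.g, (shortExact_ind φ hS).1⟩
      (shortExact_ind φ hS).2 (finite_ind φ _ h₁) (finite_ind φ _ h₂) (finite_ind φ _ h₃)


/-- `R_ℚ^*(G)`, the group of rational class functions for `G`: the `ℤ`-dual of `R_ℚ(G)`. -/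
abbrev RQDual (G : Type u) [Group G] : Type (u + 1) := RQ G →+ ℤ

/-- The transpose of an additive map. -/
def RQDual.transpose {G H : Type u} [Group G] [Group H] (x : RQ G →+ RQ H) :
    RQDual H →+ RQDual G where
  toFun f := f.comp x
  map_zero' := rfl
  map_add' _ _ := rfl

end RationalRepresentations

section GluingData

variable {G : Type u} [Group G]

open Subgroup

/-- `N_G(H)/H`. -/
abbrev W (H : Subgroup G) : Type u := normalizer (H : Set G) ⧸ H.subgroupOf (normalizer (H : Set G))

/-- `N_G(H,K) = N_G(H) ∩ N_G(K)`. -/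
abbrev NN (H K : Subgroup G) : Subgroup G := normalizer (H : Set G) ⊓ normalizer (K : Set G)

instance (H K : Subgroup G) : (H.subgroupOf (NN H K)).Normal :=
  normal_subgroupOf_of_le_normalizer inf_le_left

instance (H K : Subgroup G) : (K.subgroupOf (NN H K)).Normal :=
  normal_subgroupOf_of_le_normalizer inf_le_right

/-- The inclusion `N_G(H,K)/H → N_G(H)/H`. -/
def inclLeft (H K : Subgroup G) : NN H K ⧸ H.subgroupOf (NN H K) →* W H :=
  QuotientGroup.map _ _ (inclusion inf_le_left) fun _ hx => hx

/-- The inclusion `N_G(H,K)/K → N_G(K)/K`. -/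
def inclRight (H K : Subgroup G) : NN H K ⧸ K.subgroupOf (NN H K) →* W K :=
  QuotientGroup.map _ _ (inclusion inf_le_right) fun _ hx => hx

/-- The projection `N_G(H,K)/H → N_G(H,K)/K` for `H ≤ K`. -/
def proj {H K : Subgroup G} (h : H ≤ K) :
    NN H K ⧸ H.subgroupOf (NN H K) →* NN H K ⧸ K.subgroupOf (NN H K) :=
  QuotientGroup.map _ _ (MonoidHom.id _) fun _ hx => h hx

/-- Conjugation by `g` as a map `N_G(H)/H → N_G(ᵍH)/ᵍH`, where `ᵍH = gHg⁻¹`. -/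
def conjW (g : G) (H : Subgroup G) : W H →* W (H.map (MulAut.conj g).toMonoidHom) :=
  QuotientGroup.map _ _
    ((inclusion (le_normalizer_map (MulAut.conj g).toMonoidHom)).comp
      ((MulAut.conj g).toMonoidHom.subgroupMap (normalizer (H : Set G))))
    fun _ hx => mem_map_of_mem _ hx

/-- `ᵍH` for a non-trivial subgroup `H`. -/
abbrev conjSubgroup (g : G) (H : {H : Subgroup G // H ≠ ⊥}) : {H : Subgroup G // H ≠ ⊥} :=
  ⟨H.1.map (MulAut.conj g).toMonoidHom, fun h =>
    H.2 ((map_eq_bot_iff_of_injective _ (MulAut.conj g).injective).1 h)⟩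

variable [Finite G]

/-- The destriction map `des : R_ℚ^*(G) → R_ℚ^*(N_G(H)/H)` of the dual biset functor: the
transpose of inflation to `N_G(H)` followed by induction to `G`. -/
def des (H : Subgroup G) : RQDual G →+ RQDual (W H) :=
  RQDual.transpose
    ((RQ.ind (normalizer (H : Set G)).subtype).comp (RQ.res (QuotientGroup.mk' _)))

/-- The destriction map `R_ℚ^*(N_G(H)/H) → R_ℚ^*(N_G(H,K)/K)` for `H ≤ K`. -/
def desRel {H K : Subgroup G} (h : H ≤ K) :
    RQDual (W H) →+ RQDual (NN H K ⧸ K.subgroupOf (NN H K)) :=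
  RQDual.transpose ((RQ.ind (inclLeft H K)).comp (RQ.res (proj h)))

/-- The restriction map `R_ℚ^*(N_G(K)/K) → R_ℚ^*(N_G(H,K)/K)`: the transpose of induction. -/
def resRel (H K : Subgroup G) : RQDual (W K) →+ RQDual (NN H K ⧸ K.subgroupOf (NN H K)) :=
  RQDual.transpose (RQ.ind (inclRight H K))

/-- The conjugation map `f ↦ ᵍf`, `R_ℚ^*(N_G(H)/H) → R_ℚ^*(N_G(ᵍH)/ᵍH)`. -/
def conjDual (g : G) (H : Subgroup G) :
    RQDual (W H) →+ RQDual (W (H.map (MulAut.conj g).toMonoidHom)) :=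
  RQDual.transpose (RQ.res (conjW g H))

variable (G) in
/-- The group `lim_{1<H≤G} R_ℚ^*(N_G(H)/H)` of gluing data for `R_ℚ^*(G)`: the families that are
invariant under conjugation and destriction. -/
def gluingData : AddSubgroup (∀ H : {H : Subgroup G // H ≠ ⊥}, RQDual (W H.1)) where
  carrier := {f | (∀ (g : G) (H : {H : Subgroup G // H ≠ ⊥}),
      conjDual g H.1 (f H) = f (conjSubgroup g H)) ∧
    ∀ (H K : {H : Subgroup G // H ≠ ⊥}) (h : H.1 ≤ K.1), (H.1.subgroupOf K.1).Normal →
      desRel h (f H) = resRel H.1 K.1 (f K)}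
  zero_mem' := ⟨fun _ _ => map_zero _, fun _ _ _ _ => by
    rw [Pi.zero_apply, Pi.zero_apply, map_zero, map_zero]⟩
  add_mem' := fun {a b} ha hb => ⟨fun g H => by
      rw [Pi.add_apply, Pi.add_apply, map_add, ha.1, hb.1], fun H K h hn => by
      rw [Pi.add_apply, Pi.add_apply, map_add, map_add, ha.2 H K h hn, hb.2 H K h hn]⟩
  neg_mem' := fun {a} ha => ⟨fun g H => by
      rw [Pi.neg_apply, Pi.neg_apply, map_neg, ha.1], fun H K h hn => by
      rw [Pi.neg_apply, Pi.neg_apply, map_neg, map_neg, ha.2 H K h hn]⟩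

variable (G) in
/-- The map `r_G`, `f ↦ (des f)_{1<H≤G}`. -/
def gluingMap : RQDual G →+ ∀ H : {H : Subgroup G // H ≠ ⊥}, RQDual (W H.1) :=
  AddMonoidHom.pi fun H => des H.1

end GluingData

section SuperClass

variable (G : Type u) [Group G]

/-- `B^*(G)`, the group of super class functions: integer-valued functions on the set of
subgroups of `G` which are constant on conjugacy classes. -/
def superClass : AddSubgroup (Subgroup G → ℤ) where
  carrier := {f | ∀ (g : G) (H : Subgroup G), f (H.map (MulAut.conj g).toMonoidHom) = f H}
  zero_mem' := fun _ _ => rfl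
  add_mem' := fun ha hb g H => congrArg₂ (· + ·) (ha g H) (hb g H)
  neg_mem' := fun ha g H => congrArg (- ·) (ha g H)

variable {G}

/-- The class in `R_ℚ(G)` of the permutation module `ℚ[G/H]`. -/
def permClass [Finite G] (H : Subgroup G) : RQ G :=
  RQ.mk (Rep.ofMulAction ℚ G (G ⧸ H)) (inferInstanceAs (Module.Finite ℚ (MonoidAlgebra ℚ (G ⧸ H))))

theorem permClass_conj [Finite G] (g : G) (H : Subgroup G) :
    permClass (H.map (MulAut.conj g).toMonoidHom) = permClass H := by
  let c := (MulAut.conj g).toMonoidHom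
  have hmem : ∀ a b : G, (a * g⁻¹)⁻¹ * (b * g⁻¹) ∈ H.map c ↔ a⁻¹ * b ∈ H := fun a b => by
    have : (a * g⁻¹)⁻¹ * (b * g⁻¹) = c (a⁻¹ * b) := by simp [c, mul_assoc]
    rw [this]
    exact Subgroup.mem_map_iff_mem (f := c) (MulAut.conj g).injective
  let e : G ⧸ H ≃ G ⧸ H.map c :=
    Quotient.congr (Equiv.mulRight g⁻¹) fun a b => by
      rw [QuotientGroup.leftRel_apply, QuotientGroup.leftRel_apply]
      exact (hmem a b).symm
  have he : ∀ (x : G) (y : G ⧸ H), e (x • y) = x • e y := fun x y =>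
    QuotientGroup.induction_on y fun y =>
      congrArg (QuotientGroup.mk (s := H.map c)) (mul_assoc x y g⁻¹)
  exact (RQ.mk_eq_of_iso (Rep.mkIso (Representation.Equiv.mk
    (MonoidAlgebra.mapDomainLinearEquiv ℚ ℚ e) fun x => by
      ext y a
      simp only [LinearMap.coe_comp, Function.comp_apply, LinearEquiv.coe_coe,
        MonoidAlgebra.lsingle_apply, Representation.ofMulAction_single,
        MonoidAlgebra.mapDomainLinearEquiv_single, he])) _ _).symm

variable (G) in
/-- The transpose `R_ℚ^*(G) → B^*(G)` of the linearization map, `f ↦ (H ↦ f(ℚ[G/H]))`. -/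
def linDual [Finite G] : RQDual G →+ superClass G where
  toFun f := ⟨fun H => f (permClass H), fun g H => congrArg f (permClass_conj g H)⟩
  map_zero' := rfl
  map_add' _ _ := rfl

/-- The destriction map `B^*(G) → B^*(N_G(H)/H)`, `f ↦ (L/H ↦ f(L))`. -/
def superDes (H : Subgroup G) : superClass G →+ superClass (W H) where
  toFun f := ⟨fun L => f.1 ((L.comap (QuotientGroup.mk' _)).map (Subgroup.subtype _)), fun x L => by
    obtain ⟨n, rfl⟩ := QuotientGroup.mk'_surjective _ x
    refine Eq.trans ?_ (f.2 n ((L.comap (QuotientGroup.mk' _)).map (Subgroup.subtype _)))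
    refine congrArg f.1 (Subgroup.ext fun y => ?_)
    simp only [Subgroup.mem_map, Subgroup.mem_comap]
    constructor
    · rintro ⟨m, ⟨l, hl, hlm⟩, rfl⟩
      refine ⟨n⁻¹ * m * n, ⟨n⁻¹ * m * n, ?_, rfl⟩, by simp [mul_assoc]⟩
      have : QuotientGroup.mk' _ (n⁻¹ * m * n) = l := by
        simp only [map_mul, map_inv, ← hlm]
        simp [mul_assoc]
      rwa [this]
    · rintro ⟨_, ⟨m, hm, rfl⟩, rfl⟩
      exact ⟨n * m * n⁻¹, ⟨_, hm, by simp⟩, by simp⟩⟩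
  map_zero' := rfl
  map_add' _ _ := rfl

end SuperClass

/-- The `p`-rank of a finite group: the largest `n` such that there is an elementary abelian
subgroup of order `p ^ n`. -/
def pRank (p : ℕ) (G : Type u) [Group G] : ℕ :=
  sSup {n | ∃ E : Subgroup G, IsMulCommutative E ∧ (∀ x ∈ E, x ^ p = 1) ∧ Nat.card E = p ^ n}

end

end RatGluing

open RatGluing

/-!
A `p`-group `P` of rank one has a unique subgroup `Z` of order `p`, and every non-trivial subgroup
contains it (`exists_isSocle_of_pRank_eq_one`). This reduces the gluing problem to `P/Z`: the
condition on a gluing datum `x` for the pair `Z ≤ K` reads `des x_Z = x_K`, because `N_P(Z, K)` is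
`N_P(K)`, so `x` is determined by `x_Z` (`eq_zero_of_mem_gluingData`). That the families `r_P(f)`
are gluing data holds for every finite group and follows from the transitivity of induction and its
compatibility with inflation (`RQ.ind_comp`, `RQ.res_comp_ind`).

Everything else follows from a decomposition `R_ℚ(P) = Inf R_ℚ(P/Z) ⊕ ℤ s`, where
`s = [ℚP] - [ℚ[P/Z]]` (`IsSocle.exists_multiplicity`). The retraction onto the first summand is
`V ↦ V_Z`, which is `RQ.ind` along `P → P/Z`. The second summand consists of the representations on
which the norm of `Z` vanishes, and the point is that every cyclic submodule `ℚP v ≠ 0` of such a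
representation has class exactly `s` (`mk_span_orbit`). It is a quotient of `ℚP` on which the norm
vanishes, so it suffices that its dimension is at least `|P| - |P|/p`
(`card_le_finrank_span_orbit`). Here the structure of `P` enters. Take a maximal normal cyclic
subgroup `⟨a⟩`; either it is all of `P`, or `p = 2`, its index is `2`, and each element outside it
squares to the involution of `Z` (`IsSocle.exists_zpowers`). The minimal polynomial of `a` on
`ℚ⟨a⟩ v` is a cyclotomic polynomial, which gives the bound for cyclic `P`. In the other case an
element `g` outside `⟨a⟩` satisfies `g² = -1`, hence `⟨w, g w⟩ = 0` for every `P`-invariant scalar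
product; therefore `ℚ⟨a⟩ v` and its translate by `g` are orthogonal, and the dimension doubles.

Dually, the kernel of `des : R_ℚ^*(P) → R_ℚ^*(P/Z)` is `ℤ`, generated by the coordinate of `s`, and
`des` is onto: this is the exact sequence. If `des f` lies in the image of `lin^*` for `P/Z`, then
`f` lies in the image for `P`, since the value on `s` may be chosen freely and
`[ℚP] = s + [ℚ[P/Z]]` (`IsSocle.mem_range_linDual`). For cyclic groups induction
along `P → P/Z` shows that the linearization is an isomorphism.
-/

namespace RatGluing

/-! ### Induction and restriction on Grothendieck groups -/

section Calculus

open CategoryTheory Representation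

variable {A B A' B' : Type u} [Group A] [Group B] [Group A'] [Group B']

theorem RQ.hom_ext {G : Type u} [Group G] {M : Type*} [AddCommGroup M] {f g : RQ G →+ M}
    (h : ∀ (V : Rep.{u} ℚ G) (hV : Module.Finite ℚ V), f (RQ.mk V hV) = g (RQ.mk V hV)) :
    f = g := by
  refine QuotientAddGroup.addMonoidHom_ext _ (FreeAbelianGroup.lift_ext _ _ fun V => ?_)
  exact h V.1 V.2

theorem RQ.res_mk (φ : A →* B) (V : Rep.{u} ℚ B) (hV : Module.Finite ℚ V) :
    RQ.res φ (RQ.mk V hV) = RQ.mk (Rep.res φ V) hV :=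
  RQ.lift_mk _ _ V hV

theorem RQ.ind_mk [Finite A] [Finite B] (φ : A →* B) (V : Rep.{u} ℚ A) (hV : Module.Finite ℚ V) :
    RQ.ind φ (RQ.mk V hV) = RQ.mk (Rep.ind φ V) (finite_ind φ V hV) :=
  RQ.lift_mk _ _ V hV

/-- The defining relation of `ℚB ⊗_{ℚA} V`, in Mathlib's convention for `IndV`, where `B` acts on
`⟦h ⊗ v⟧` through `h ↦ h b⁻¹`. -/
theorem indV_mk_map (φ : A →* B) {V : Type*} [AddCommGroup V] [Module ℚ V]
    (ρ : Representation ℚ A V) (a : A) (b : B) (v : V) :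
    IndV.mk φ ρ (φ a * b) (ρ a v) = IndV.mk φ ρ b v := by
  have := Coinvariants.mk_self_apply (Representation.tprod ((leftRegular ℚ B).comp φ) ρ) a
    (MonoidAlgebra.single b 1 ⊗ₜ v)
  simpa [Representation.ofMulAction_single] using this

theorem nonempty_iso_of_bijective {V W : Rep.{u} ℚ A} (f : V ⟶ W)
    (hf : Function.Bijective f.hom) : Nonempty (V ≅ W) :=
  ⟨Rep.mkIso (f.hom.ofBijective hf)⟩

/-- A criterion for `X` to be induced from `V` through `j : V → X`: the translates of `j V` span
`X`, and there is a linear retraction `b` of `X` to the induced representation. -/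
theorem ind_iso (φ : A →* B) {V : Rep.{u} ℚ A} {X : Rep.{u} ℚ B} (j : V ⟶ Rep.res φ X)
    (b : X →ₗ[ℚ] IndV φ V.ρ)
    (hb : ∀ (h : B) (v : V), b (X.ρ h⁻¹ (j.hom v)) = IndV.mk φ V.ρ h v)
    (hX : ∀ x : X, x ∈ Submodule.span ℚ (Set.range fun y : B × V => X.ρ y.1⁻¹ (j.hom y.2))) :
    Nonempty (Rep.ind φ V ≅ X) := by
  let f := (Rep.indResHomEquiv φ V X).symm j
  have hf : ∀ (h : B) (v : V), f.hom (IndV.mk φ V.ρ h v) = X.ρ h⁻¹ (j.hom v) := fun h v => by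
    simp [f]
  have hbf : b ∘ₗ f.hom.toLinearMap = LinearMap.id := by
    refine IndV.hom_ext _ _ fun h => LinearMap.ext fun v => ?_
    exact (congrArg b (hf h v)).trans (hb h v)
  refine nonempty_iso_of_bijective f ⟨?_, ?_⟩
  · exact Function.LeftInverse.injective (g := b) fun x => LinearMap.congr_fun hbf x
  · intro x
    have : Submodule.span ℚ (Set.range fun y : B × V => X.ρ y.1⁻¹ (j.hom y.2)) ≤
        LinearMap.range f.hom.toLinearMap := by
      rw [Submodule.span_le]
      rintro _ ⟨y, rfl⟩
      exact ⟨IndV.mk φ V.ρ y.1 y.2, hf y.1 y.2⟩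
    exact this (hX x)

theorem RQ.ind_comp [Finite A] [Finite B] [Finite A'] (φ : A →* B) (ψ : A' →* A) :
    (RQ.ind φ).comp (RQ.ind ψ) = RQ.ind (φ.comp ψ) := by
  refine RQ.hom_ext fun V hV => ?_
  rw [AddMonoidHom.comp_apply, RQ.ind_mk, RQ.ind_mk, RQ.ind_mk]
  exact RQ.mk_eq_of_iso ((((Rep.indResAdjunction.{u} ℚ ψ).comp
    (Rep.indResAdjunction.{u} ℚ φ)).leftAdjointUniq
      (Rep.indResAdjunction.{u} ℚ (φ.comp ψ))).app V) _ _

theorem RQ.res_comp (φ : A →* B) (ψ : A' →* A) :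
    (RQ.res ψ).comp (RQ.res φ) = RQ.res (φ.comp ψ) := by
  refine RQ.hom_ext fun V hV => ?_
  rw [AddMonoidHom.comp_apply, RQ.res_mk, RQ.res_mk, RQ.res_mk]
  rfl

/-- The linear map out of `ℚB ⊗_{ℚA} V` given by a family of linear maps indexed by `B`. -/
noncomputable def indVLift (φ : A →* B) {V M : Type*} [AddCommGroup V] [Module ℚ V] [AddCommGroup M]
    [Module ℚ M] (ρ : Representation ℚ A V) (F : B → V →ₗ[ℚ] M)
    (hF : ∀ a b v, F (φ a * b) (ρ a v) = F b v) : IndV φ ρ →ₗ[ℚ] M :=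
  Coinvariants.lift _ (TensorProduct.lift <| (Finsupp.lift _ _ _ F) ∘ₗ
      (MonoidAlgebra.coeffLinearEquiv ℚ).toLinearMap) fun g ↦ by
      ext h x
      simp only [LinearMap.coe_comp, Function.comp_apply, MonoidAlgebra.lsingle_apply]
      simp [ofMulAction_single, hF]

theorem indVLift_mk (φ : A →* B) {V M : Type*} [AddCommGroup V] [Module ℚ V] [AddCommGroup M]
    [Module ℚ M] (ρ : Representation ℚ A V) (F : B → V →ₗ[ℚ] M)
    (hF : ∀ a b v, F (φ a * b) (ρ a v) = F b v) (b : B) (v : V) :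
    indVLift φ ρ F hF (IndV.mk φ ρ b v) = F b v := by
  simp [indVLift]

theorem mem_span_indV_mk (φ : A →* B) {V : Type*} [AddCommGroup V] [Module ℚ V]
    (ρ : Representation ℚ A V) (x : IndV φ ρ) :
    x ∈ Submodule.span ℚ (Set.range fun y : B × V => IndV.mk φ ρ y.1 y.2) := by
  obtain ⟨x, rfl⟩ := Coinvariants.mk_surjective _ x
  induction x using TensorProduct.induction_on with
  | zero => rw [map_zero]; exact zero_mem _
  | add x y hx hy => rw [map_add]; exact add_mem hx hy
  | tmul x v =>
    induction x using MonoidAlgebra.induction_linear with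
    | zero => rw [TensorProduct.zero_tmul, map_zero]; exact zero_mem _
    | add x y hx hy => rw [TensorProduct.add_tmul, map_add]; exact add_mem hx hy
    | single b c =>
      have : (MonoidAlgebra.single b c : MonoidAlgebra ℚ B) = c • MonoidAlgebra.single b 1 := by
        simp
      rw [this, ← TensorProduct.smul_tmul', map_smul]
      exact Submodule.smul_mem _ _ (Submodule.subset_span ⟨(b, v), rfl⟩)

/-- Base change: for a commutative square `φ π' = π φ'` with `π`, `π'` surjective and such that
`ker π'` maps onto `ker π`, inflation along `π` commutes with induction. -/
theorem RQ.res_comp_ind [Finite A] [Finite B] [Finite A'] [Finite B'] (φ : A →* B) (π : B' →* B)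
    (φ' : A' →* B') (π' : A' →* A) (hcomm : φ.comp π' = π.comp φ')
    (hπ : Function.Surjective π) (hπ' : Function.Surjective π')
    (hker : ∀ b, π b = 1 → ∃ a, φ' a = b ∧ π' a = 1) :
    (RQ.res π).comp (RQ.ind φ) = (RQ.ind φ').comp (RQ.res π') := by
  refine RQ.hom_ext fun V hV => ?_
  rw [AddMonoidHom.comp_apply, AddMonoidHom.comp_apply, RQ.ind_mk, RQ.res_mk, RQ.res_mk, RQ.ind_mk]
  have hc : ∀ a, φ (π' a) = π (φ' a) := fun a => DFunLike.congr_fun hcomm a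
  let j : Rep.res π' V ⟶ Rep.res φ' (Rep.res π (Rep.ind φ V)) := Rep.ofHom
    ⟨IndV.mk φ V.ρ 1, fun a => LinearMap.ext fun v => by
      change IndV.mk φ V.ρ 1 (V.ρ (π' a) v) =
        Representation.ind φ V.ρ (π (φ' a)) (IndV.mk φ V.ρ 1 v)
      rw [Representation.ind_mk, ← indV_mk_map φ V.ρ (π' a) (1 * (π (φ' a))⁻¹), hc]
      simp⟩
  -- the inverse of the natural map sends `⟦b ⊗ v⟧` to `⟦σ b ⊗ v⟧` for any section `σ` of `π`
  let σ := Function.surjInv hπ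
  have hσ : ∀ b, π (σ b) = b := Function.surjInv_eq hπ
  have key : ∀ (b₁ b₂ : B') (v : V), π b₁ = π b₂ →
      IndV.mk φ' (Rep.res π' V).ρ b₁ v = IndV.mk φ' (Rep.res π' V).ρ b₂ v := fun b₁ b₂ v h => by
    obtain ⟨a, ha, ha'⟩ := hker (b₁ * b₂⁻¹) (by simp [h])
    have := indV_mk_map φ' (Rep.res π' V).ρ a b₂ v
    rw [ha, show (Rep.res π' V).ρ a v = v by simp [ha']] at this
    simpa using this
  let b : IndV φ V.ρ →ₗ[ℚ] IndV φ' (Rep.res π' V).ρ :=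
    indVLift φ V.ρ (fun b => IndV.mk φ' (Rep.res π' V).ρ (σ b)) fun a b v => by
      obtain ⟨a, rfl⟩ := hπ' a
      rw [← indV_mk_map φ' (Rep.res π' V).ρ a (σ b)]
      exact key _ _ _ (by rw [map_mul, hσ, hσ, hc])
  obtain ⟨e⟩ := ind_iso φ' (X := Rep.res π (Rep.ind φ V)) j b (fun h v => by
      change b (Representation.ind φ V.ρ (π h⁻¹) (IndV.mk φ V.ρ 1 v)) = _
      rw [Representation.ind_mk, indVLift_mk]
      exact key _ _ _ (by simp [hσ])) (fun x => by
      refine Submodule.span_mono ?_ (mem_span_indV_mk φ V.ρ x)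
      rintro _ ⟨⟨y, v⟩, rfl⟩
      obtain ⟨h, rfl⟩ := hπ y
      refine ⟨(h, v), ?_⟩
      change Representation.ind φ V.ρ (π h⁻¹) (IndV.mk φ V.ρ 1 v) = _
      rw [Representation.ind_mk]
      simp)
  exact (RQ.mk_eq_of_iso e _ _).symm

theorem RQ.ind_comp_res_of_surjective [Finite A] [Finite B] (π : A →* B)
    (hπ : Function.Surjective π) : (RQ.ind π).comp (RQ.res π) = AddMonoidHom.id _ := by
  refine RQ.hom_ext fun V hV => ?_
  rw [AddMonoidHom.comp_apply, RQ.res_mk, RQ.ind_mk, AddMonoidHom.id_apply]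
  obtain ⟨e⟩ := ind_iso π (V := Rep.res π V) (X := V) (𝟙 _) (IndV.mk π (Rep.res π V).ρ 1)
    (fun h v => by
      obtain ⟨a, rfl⟩ := hπ h
      rw [← indV_mk_map π (Rep.res π V).ρ a]
      simp) (fun x => Submodule.subset_span ⟨(1, x), by simp⟩)
  exact RQ.mk_eq_of_iso e _ _

theorem RQ.ind_permClass [Finite A] [Finite B] (φ : A →* B) (H : Subgroup A) :
    RQ.ind φ (permClass H) = permClass (H.map φ) := by
  rw [permClass, RQ.ind_mk, permClass]
  let V := Rep.ofMulAction ℚ A (A ⧸ H)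
  let X := Rep.ofMulAction ℚ B (B ⧸ H.map φ)
  let f : A ⧸ H → B ⧸ H.map φ := Quotient.map' φ fun a b h => by
    rw [QuotientGroup.leftRel_apply] at h ⊢
    exact ⟨_, h, by simp⟩
  have hf : ∀ a : A, f (QuotientGroup.mk a) = QuotientGroup.mk (φ a) := fun _ => rfl
  let j : V ⟶ Rep.res φ X := Rep.ofHom
    ⟨MonoidAlgebra.mapDomainLinearMap ℚ ℚ f, fun a => MonoidAlgebra.lhom_ext' fun x =>
      LinearMap.ext_ring <| by
        obtain ⟨x, rfl⟩ := QuotientGroup.mk_surjective x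
        change MonoidAlgebra.mapDomainLinearMap ℚ ℚ f
          (Representation.ofMulAction ℚ A (A ⧸ H) a (MonoidAlgebra.single (x : A ⧸ H) 1)) =
          Representation.ofMulAction ℚ B (B ⧸ H.map φ) (φ a)
            (MonoidAlgebra.mapDomainLinearMap ℚ ℚ f (MonoidAlgebra.single (x : A ⧸ H) 1))
        rw [Representation.ofMulAction_single, MonoidAlgebra.mapDomainLinearMap_single,
          MonoidAlgebra.mapDomainLinearMap_single, Representation.ofMulAction_single, hf,
          MulAction.Quotient.smul_coe, MulAction.Quotient.smul_coe, hf, smul_eq_mul, smul_eq_mul,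
          map_mul]⟩
  have hj : ∀ a : A, j.hom (MonoidAlgebra.single (QuotientGroup.mk a) 1) =
      MonoidAlgebra.single (QuotientGroup.mk (φ a)) 1 := fun a =>
    MonoidAlgebra.mapDomainLinearMap_single _ _ _
  have hact : ∀ b c : B, X.ρ b (MonoidAlgebra.single (QuotientGroup.mk c) 1) =
      MonoidAlgebra.single (QuotientGroup.mk (b * c)) 1 := fun b c =>
    Representation.ofMulAction_single _ _ _
  have hact' : ∀ a c : A, V.ρ a (MonoidAlgebra.single (QuotientGroup.mk c) 1) =
      MonoidAlgebra.single (QuotientGroup.mk (a * c)) 1 := fun b c =>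
    Representation.ofMulAction_single _ _ _
  let g : B ⧸ H.map φ → IndV φ V.ρ := Quotient.lift
    (fun b => IndV.mk φ V.ρ b⁻¹ (MonoidAlgebra.single (QuotientGroup.mk 1) 1)) (by
      intro b c h
      obtain ⟨x, hx, hxb⟩ := QuotientGroup.leftRel_apply.1 h
      have hc : b⁻¹ = φ x * c⁻¹ := by rw [hxb]; group
      have : V.ρ x (MonoidAlgebra.single (QuotientGroup.mk 1) 1) =
          MonoidAlgebra.single (QuotientGroup.mk 1) 1 := by
        rw [hact', mul_one, (QuotientGroup.eq (s := H)).2 (by simpa using hx : x⁻¹ * 1 ∈ H)]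
      change IndV.mk φ V.ρ b⁻¹ _ = IndV.mk φ V.ρ c⁻¹ _
      rw [hc, ← indV_mk_map φ V.ρ x c⁻¹, this])
  let b : X →ₗ[ℚ] IndV φ V.ρ := (Finsupp.lift _ _ _ g) ∘ₗ
      (MonoidAlgebra.coeffLinearEquiv ℚ).toLinearMap
  have hb : ∀ c : B, b (MonoidAlgebra.single (QuotientGroup.mk c) 1) =
      IndV.mk φ V.ρ c⁻¹ (MonoidAlgebra.single (QuotientGroup.mk 1) 1) := fun c =>
    (Finsupp.sum_single_index (h := fun x (r : ℚ) => r • g x) (zero_smul _ _)).trans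
      (one_smul _ _)
  obtain ⟨e⟩ := ind_iso φ j b (fun h v => by
    suffices b ∘ₗ X.ρ h⁻¹ ∘ₗ j.hom.toLinearMap = IndV.mk φ V.ρ h from LinearMap.congr_fun this v
    refine MonoidAlgebra.lhom_ext' fun x => LinearMap.ext_ring ?_
    obtain ⟨x, rfl⟩ := QuotientGroup.mk_surjective x
    change b (X.ρ h⁻¹ (j.hom (MonoidAlgebra.single (QuotientGroup.mk x) 1))) =
      IndV.mk φ V.ρ h (MonoidAlgebra.single (QuotientGroup.mk x) 1)
    rw [hj, hact, hb, ← indV_mk_map φ V.ρ x⁻¹ h, hact', inv_mul_cancel, mul_inv_rev, inv_inv,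
      map_inv]) (fun x => by
    induction x using MonoidAlgebra.induction_linear with
    | zero => exact zero_mem _
    | add x y hx hy => exact add_mem hx hy
    | single b c =>
      have : (MonoidAlgebra.single b c : MonoidAlgebra ℚ (B ⧸ H.map φ)) =
          c • MonoidAlgebra.single b 1 := by simp
      rw [this]
      obtain ⟨b, rfl⟩ := QuotientGroup.mk_surjective b
      refine Submodule.smul_mem _ _ (Submodule.subset_span
        ⟨(b⁻¹, MonoidAlgebra.single (QuotientGroup.mk 1) 1), ?_⟩)
      change X.ρ b⁻¹⁻¹ (j.hom (MonoidAlgebra.single (QuotientGroup.mk 1) 1)) = _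
      rw [hj, hact, inv_inv, map_one, mul_one])
  exact RQ.mk_eq_of_iso e _ _

theorem RQ.res_permClass [Finite A] [Finite B] (π : A →* B) (hπ : Function.Surjective π)
    (H : Subgroup B) : RQ.res π (permClass H) = permClass (H.comap π) := by
  rw [permClass, RQ.res_mk, permClass]
  let f : A ⧸ H.comap π → B ⧸ H := Quotient.map' π fun a b h => by
    rw [QuotientGroup.leftRel_apply] at h ⊢
    simpa using h
  have hf : Function.Bijective f := by
    constructor
    · intro a b h
      obtain ⟨a, rfl⟩ := QuotientGroup.mk_surjective a
      obtain ⟨b, rfl⟩ := QuotientGroup.mk_surjective b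
      have h : (QuotientGroup.mk (π a) : B ⧸ H) = QuotientGroup.mk (π b) := h
      rw [QuotientGroup.eq] at h ⊢
      simpa using h
    · intro b
      obtain ⟨b, rfl⟩ := QuotientGroup.mk_surjective b
      obtain ⟨a, rfl⟩ := hπ b
      exact ⟨QuotientGroup.mk a, rfl⟩
  let e : A ⧸ H.comap π ≃ B ⧸ H := Equiv.ofBijective f hf
  have he : ∀ (x : A) (y : A ⧸ H.comap π), e (x • y) = π x • e y := fun x y =>
    QuotientGroup.induction_on y fun y =>
      congrArg (QuotientGroup.mk (s := H)) (map_mul π x y)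
  exact (RQ.mk_eq_of_iso (Rep.mkIso (ρ := Representation.ofMulAction ℚ A (A ⧸ H.comap π))
    (σ := (Representation.ofMulAction ℚ B (B ⧸ H)).comp π) (Representation.Equiv.mk
    (MonoidAlgebra.mapDomainLinearEquiv ℚ ℚ e) fun x => by
      ext y a
      simp only [LinearMap.coe_comp, Function.comp_apply, LinearEquiv.coe_coe, MonoidHom.coe_comp,
        MonoidAlgebra.lsingle_apply, Representation.ofMulAction_single,
        MonoidAlgebra.mapDomainLinearEquiv_single, he])) _ _).symm

end Calculus

/-! ### The image of the gluing map consists of gluing data -/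

section Destriction

open CategoryTheory Representation Subgroup

variable {G : Type u} [Group G]

theorem RQ.res_eq_id_of_inner (g : G) : RQ.res (MulAut.conj g).toMonoidHom = AddMonoidHom.id _ := by
  refine RQ.hom_ext fun V hV => ?_
  rw [RQ.res_mk, AddMonoidHom.id_apply]
  let f : V ⟶ Rep.res (MulAut.conj g).toMonoidHom V := Rep.ofHom ⟨V.ρ g, fun x => by
    change _ = V.ρ (g * x * g⁻¹) ∘ₗ _
    rw [← Module.End.mul_eq_comp, ← Module.End.mul_eq_comp, ← map_mul, ← map_mul]
    simp⟩
  obtain ⟨e⟩ := nonempty_iso_of_bijective f (V.ρ.apply_bijective g)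
  exact (RQ.mk_eq_of_iso e _ _).symm

variable [Finite G]

/-- Conjugation of destrictions: base change along the automorphism `conj g` of `G`, which acts
trivially on `R_ℚ(G)`. -/
theorem conjDual_des (g : G) (H : Subgroup G) (f : RQDual G) :
    conjDual g H (des H f) = des (H.map (MulAut.conj g).toMonoidHom) f := by
  let c := (MulAut.conj g).toMonoidHom
  let n : normalizer (H : Set G) →* normalizer ((H.map c : Subgroup G) : Set G) :=
    (inclusion (le_normalizer_map c)).comp (c.subgroupMap (normalizer (H : Set G)))
  have hn : Function.Surjective n := by
    rintro ⟨y, hy⟩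
    refine ⟨⟨g⁻¹ * y * g, ?_⟩, Subtype.ext ?_⟩
    · rw [mem_normalizer_iff] at hy ⊢
      intro h
      have := hy (g * h * g⁻¹)
      rw [show g * h * g⁻¹ = c h from rfl, mem_map_iff_mem (MulAut.conj g).injective] at this
      rw [this, show y * c h * y⁻¹ = c (g⁻¹ * y * g * h * (g⁻¹ * y * g)⁻¹) by simp [c, mul_assoc],
        mem_map_iff_mem (MulAut.conj g).injective]
    · change g * (g⁻¹ * y * g) * g⁻¹ = y
      group
  have h₁ : (RQ.res (QuotientGroup.mk' (H.subgroupOf (normalizer (H : Set G))))).comp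
      (RQ.res (conjW g H)) = (RQ.res n).comp (RQ.res (QuotientGroup.mk' _)) := by
    rw [RQ.res_comp, RQ.res_comp]
    rfl
  have h₂ := RQ.res_comp_ind (normalizer ((H.map c : Subgroup G) : Set G)).subtype c
    (normalizer (H : Set G)).subtype n (by ext; rfl) (MulAut.conj g).surjective hn fun b hb =>
      ⟨1, by rw [map_one, (map_eq_one_iff c (MulAut.conj g).injective).1 hb], map_one n⟩
  rw [RQ.res_eq_id_of_inner, AddMonoidHom.id_comp] at h₂
  change f.comp (((RQ.ind _).comp (RQ.res _)).comp (RQ.res _)) = f.comp ((RQ.ind _).comp (RQ.res _))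
  rw [AddMonoidHom.comp_assoc _ _ (RQ.ind _), h₁, h₂]
  rfl

/-- Both sides are transposes of inflation from `N_G(H,K)/K` to `N_G(H,K)` followed by induction to
`G`. Normality of `H` in `K` makes `K` a subgroup of `N_G(H,K)`, as base change for `K` requires. -/
theorem desRel_des {H K : Subgroup G} (h : H ≤ K) (hn : (H.subgroupOf K).Normal) (f : RQDual G) :
    desRel h (des H f) = resRel H K (des K f) := by
  have h₁ := RQ.res_comp_ind (inclLeft H K) (QuotientGroup.mk' _) (inclusion inf_le_left)
    (QuotientGroup.mk' _) rfl (QuotientGroup.mk'_surjective _) (QuotientGroup.mk'_surjective _)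
    fun b hb => by
      have hbH : (b : G) ∈ H := (QuotientGroup.eq_one_iff b).1 hb
      exact ⟨⟨b, b.2, le_normalizer (h hbH)⟩, rfl, (QuotientGroup.eq_one_iff _).2 hbH⟩
  have h₂ := RQ.res_comp_ind (inclRight H K) (QuotientGroup.mk' _) (inclusion inf_le_right)
    (QuotientGroup.mk' _) rfl (QuotientGroup.mk'_surjective _) (QuotientGroup.mk'_surjective _)
    fun b hb => by
      have hbK : (b : G) ∈ K := (QuotientGroup.eq_one_iff b).1 hb
      exact ⟨⟨b, (normal_subgroupOf_iff_le_normalizer h).1 hn hbK, b.2⟩, rfl,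
        (QuotientGroup.eq_one_iff _).2 hbK⟩
  have h₃ : (RQ.res (QuotientGroup.mk' (H.subgroupOf (NN H K)))).comp (RQ.res (proj h)) =
      RQ.res (QuotientGroup.mk' (K.subgroupOf (NN H K))) := by
    rw [RQ.res_comp]
    rfl
  have e : ((RQ.ind (normalizer (H : Set G)).subtype).comp (RQ.res (QuotientGroup.mk' _))).comp
        ((RQ.ind (inclLeft H K)).comp (RQ.res (proj h))) =
      ((RQ.ind (normalizer (K : Set G)).subtype).comp (RQ.res (QuotientGroup.mk' _))).comp
        (RQ.ind (inclRight H K)) := by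
    rw [AddMonoidHom.comp_assoc, AddMonoidHom.comp_assoc, h₂,
      ← AddMonoidHom.comp_assoc _ (RQ.ind (inclLeft H K)), h₁, AddMonoidHom.comp_assoc, h₃,
      ← AddMonoidHom.comp_assoc, ← AddMonoidHom.comp_assoc, RQ.ind_comp, RQ.ind_comp]
    rfl
  exact congrArg (AddMonoidHom.comp f) e

theorem gluingMap_mem_gluingData (f : RQDual G) : gluingMap G f ∈ gluingData G :=
  ⟨fun g H => conjDual_des g H.1 f, fun _ _ h hn => desRel_des h hn f⟩

theorem superDes_linDual (Q : Subgroup G) (f : RQDual G) :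
    superDes Q (linDual G f) = linDual (W Q) (des Q f) := by
  refine Subtype.ext (funext fun L => ?_)
  change f (permClass _) = f (RQ.ind _ (RQ.res _ (permClass L)))
  rw [RQ.res_permClass _ (QuotientGroup.mk'_surjective _), RQ.ind_permClass]

end Destriction

/-! ### `p`-groups with a unique minimal subgroup -/

section PGroups

open Subgroup

/-- `Z` has order `p` and is contained in every non-trivial subgroup: for a `p`-group, `Z` is the
only subgroup of order `p`. -/
structure IsSocle {P : Type*} [Group P] (p : ℕ) (Z : Subgroup P) : Prop where
  card_eq : Nat.card Z = p
  le_of_ne_bot : ∀ H : Subgroup P, H ≠ ⊥ → Z ≤ H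

/-- Suppose that the class of `t` is annihilated by `r - 1` in `ℤ/p^n` but is not a multiple of `s`,
and that `r ≠ 1` in `ℤ/p^n`. Then the `p`-part of `s` in `ℤ/p^n` is at least `p²` and does not
divide `t`. -/
theorem exists_sq_le_pow_dvd {p n : ℕ} (hp : p.Prime) {r s t : ℤ}
    (h₁ : (p : ℤ) ^ n ∣ (r - 1) * t) (h₂ : ¬ (p : ℤ) ^ n ∣ r - 1)
    (h₃ : ∀ i : ℤ, ¬ (p : ℤ) ^ n ∣ i * s + t) :
    ∃ k ≤ n, 2 ≤ k ∧ (p : ℤ) ^ k ∣ s ∧ ¬ (p : ℤ) ^ k ∣ t := by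
  obtain ⟨k, hk, hd⟩ := (Nat.dvd_prime_pow hp).1 (show Int.gcd s (p ^ n) ∣ p ^ n by
    have := Int.gcd_dvd_right s (p ^ n : ℤ)
    exact_mod_cast this)
  have hs : (p : ℤ) ^ k ∣ s := by
    have := Int.gcd_dvd_left s (p ^ n : ℤ)
    rw [hd] at this
    exact_mod_cast this
  have ht : ¬ (p : ℤ) ^ k ∣ t := by
    rintro ⟨c, rfl⟩
    have hb := Int.gcd_eq_gcd_ab s (p ^ n : ℤ)
    rw [hd] at hb
    push_cast at hb
    refine h₃ (-(Int.gcdA s (p ^ n) * c)) ⟨Int.gcdB s (p ^ n) * c, ?_⟩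
    linear_combination c * hb
  refine ⟨k, hk, ?_, hs, ht⟩
  by_contra hk2
  have hpt : ¬ (p : ℤ) ∣ t := by
    intro h
    interval_cases k
    · simp at ht
    · simp [h] at ht
  have hc : IsCoprime ((p : ℤ) ^ n) t :=
    (((Nat.prime_iff_prime_int.1 hp).coprime_iff_not_dvd).2 hpt).pow_left
  exact h₂ (hc.dvd_of_dvd_mul_right h₁)

theorem not_sq_dvd_geom_sum {p : ℕ} (hp : p.Prime) (hp2 : p ≠ 2) {r : ℤ} (hr : (p : ℤ) ∣ r - 1) :
    ¬ (p : ℤ) ^ 2 ∣ ∑ j ∈ Finset.range p, r ^ j := by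
  obtain ⟨c, hc⟩ := hr
  have hr : r = 1 + p * c := by linear_combination hc
  have h : ∀ m : ℕ, (p : ℤ) ^ 2 ∣ r ^ m - (1 + m * (p * c)) := by
    intro m
    induction m with
    | zero => simp
    | succ m ih =>
      obtain ⟨d, hd⟩ := ih
      refine ⟨d * r + m * c ^ 2, ?_⟩
      push_cast
      rw [pow_succ]
      linear_combination r * hd + (1 + m * (p * c)) * hr
  have h2 : (p : ℤ) ^ 2 ∣ ∑ j ∈ Finset.range p, (r ^ j - (1 + j * (p * c))) :=
    Finset.dvd_sum fun j _ => h j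
  rw [Finset.sum_sub_distrib, Finset.sum_add_distrib, ← Finset.sum_mul] at h2
  have h3 : (p : ℤ) ∣ ∑ j ∈ Finset.range p, (j : ℤ) := by
    obtain ⟨q, hq⟩ := hp.odd_of_ne_two hp2
    have := Finset.sum_range_id_mul_two p
    have h4 : ((∑ j ∈ Finset.range p, j : ℕ) : ℤ) * 2 = p * (2 * q) := by
      rw [show (2 * q : ℤ) = ((p - 1 : ℕ) : ℤ) by rw [hq]; simp]
      exact_mod_cast this
    refine ⟨q, ?_⟩
    push_cast at h4
    linarith
  obtain ⟨e, he⟩ := h3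
  rw [he] at h2
  intro h5
  have h6 : (p : ℤ) ^ 2 ∣ p := by
    have h7 : (p : ℤ) ^ 2 ∣ p * e * (p * c) := ⟨e * c, by ring⟩
    have := dvd_sub (dvd_sub h5 h2) h7
    simpa using this
  have h8 : p ^ 2 ∣ p := by exact_mod_cast h6
  have := Nat.le_of_dvd hp.pos h8
  nlinarith [hp.two_le]

/-- Let `r ≠ 1` and `r t = t` in `ℤ/p^n`. If `t` is not a multiple
of the norm `1 + r + ⋯ + r^(p-1)`, then `p = 2`, `r = -1` and `2t = 0` in `ℤ/p^n`. -/
theorem eq_two_of_norm_ne {p n : ℕ} (hp : p.Prime) {r t : ℤ}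
    (h₁ : (p : ℤ) ^ n ∣ (r - 1) * t) (h₂ : ¬ (p : ℤ) ^ n ∣ r - 1)
    (h₃ : ∀ i : ℤ, ¬ (p : ℤ) ^ n ∣ i * (∑ j ∈ Finset.range p, r ^ j) + t) :
    p = 2 ∧ (p : ℤ) ^ n ∣ r + 1 ∧ (p : ℤ) ^ n ∣ 2 * t := by
  have hpr : (p : ℤ) ∣ r - 1 := by
    by_contra h
    have hc : IsCoprime ((p : ℤ) ^ n) (r - 1) :=
      (((Nat.prime_iff_prime_int.1 hp).coprime_iff_not_dvd).2 h).pow_left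
    exact h₃ 0 (by simpa using hc.dvd_of_dvd_mul_left h₁)
  obtain ⟨k, hkn, hk2, hks, hkt⟩ := exists_sq_le_pow_dvd hp h₁ h₂ h₃
  have hp2 : p = 2 := by
    by_contra hp2
    exact not_sq_dvd_geom_sum hp hp2 hpr ((pow_dvd_pow _ hk2).trans hks)
  subst hp2
  have hs : (∑ j ∈ Finset.range 2, r ^ j) = r + 1 := by simp [Finset.sum_range_succ, add_comm]
  rw [hs] at hks
  have h4 : (4 : ℤ) ∣ r + 1 := by
    have := (pow_dvd_pow (2 : ℤ) hk2).trans hks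
    norm_num at this
    exact this
  push_cast at h₁
  have ht : (2 : ℤ) ^ n ∣ 2 * t := by
    obtain ⟨q, hq⟩ := h4
    have hr : (r - 1) * t = (2 * q - 1) * (2 * t) := by linear_combination t * hq
    rw [hr] at h₁
    refine IsCoprime.dvd_of_dvd_mul_left (IsCoprime.pow_left ?_) h₁
    exact ⟨q, -1, by ring⟩
  push_cast at hks hkt ⊢
  refine ⟨trivial, ?_, ht⟩
  have : k = n := by
    by_contra hkn'
    obtain ⟨m, rfl⟩ : ∃ m, n = m + 1 := ⟨n - 1, by omega⟩
    rw [pow_succ'] at ht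
    exact hkt ((pow_dvd_pow _ (by omega)).trans (Int.dvd_of_mul_dvd_mul_left (by norm_num) ht))
  exact this ▸ hks

variable {P : Type*} [Group P] {p : ℕ} [hp : Fact p.Prime] {Z : Subgroup P}

theorem IsSocle.mem_of_pow_eq_one [Finite P] (hZ : IsSocle p Z) {x : P} (hx : x ^ p = 1) :
    x ∈ Z := by
  by_cases h1 : x = 1
  · exact h1 ▸ one_mem Z
  have hle := hZ.le_of_ne_bot (zpowers x) (by simpa using h1)
  have hcard : Nat.card (zpowers x) = p := by
    rw [Nat.card_zpowers]
    exact orderOf_eq_prime hx h1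
  rw [eq_of_le_of_card_ge hle (by rw [hcard, hZ.card_eq])]
  exact mem_zpowers x

theorem IsSocle.ne_bot (hZ : IsSocle p Z) : Z ≠ ⊥ := by
  rintro rfl
  have := hZ.card_eq
  rw [card_bot] at this
  exact hp.out.one_lt.ne this

theorem IsSocle.normal [Finite P] (hZ : IsSocle p Z) : Z.Normal := by
  refine ⟨fun z hz g => ?_⟩
  refine hZ.mem_of_pow_eq_one ?_
  have : z ^ p = 1 := by
    have := pow_card_eq_one' (x := (⟨z, hz⟩ : Z))
    rw [hZ.card_eq] at this
    exact congrArg Subtype.val this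
  rw [conj_pow, this]; simp

theorem mul_pow_of_conj {a g : P} {r : ℕ} (h : g * a * g⁻¹ = a ^ r) (i : ℤ) (m : ℕ) :
    (a ^ i * g) ^ m = a ^ (i * ∑ j ∈ Finset.range m, (r : ℤ) ^ j) * g ^ m := by
  have hc : ∀ k : ℤ, g * a ^ k = a ^ ((r : ℤ) * k) * g := fun k => by
    rw [zpow_mul, zpow_natCast, ← h, conj_zpow]
    group
  induction m with
  | zero => simp
  | succ m ih =>
    have e : i * ∑ j ∈ Finset.range (m + 1), (r : ℤ) ^ j =
        i + r * (i * ∑ j ∈ Finset.range m, (r : ℤ) ^ j) := by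
      rw [geom_sum_succ]
      ring
    rw [pow_succ', ih, e, zpow_add, pow_succ', mul_assoc, ← mul_assoc g, hc]
    simp only [mul_assoc]

variable [Finite P]

/-- If `g ∉ ⟨a⟩` acts non-trivially on the normal subgroup `⟨a⟩` and `g^p ∈ ⟨a⟩`, then `p = 2` and
`g` acts by inversion: otherwise `g^p` is a norm, and some `a^i g` has order `p` although it is not
in `Z`. -/
theorem IsSocle.eq_two_of_not_mem (hZ : IsSocle p Z) {a g : P} {n : ℕ} (ha : orderOf a = p ^ n)
    (hZa : Z ≤ zpowers a) (hnorm : (zpowers a).Normal) (hg : g ∉ zpowers a)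
    (hga : ¬ Commute g a) (hgp : g ^ p ∈ zpowers a) :
    p = 2 ∧ g * a * g⁻¹ = a⁻¹ ∧ g ^ 2 ∈ Z ∧ g ^ 2 ≠ 1 := by
  obtain ⟨r, hr⟩ := mem_powers_iff_mem_zpowers.2 (hnorm.conj_mem a (mem_zpowers a) g)
  obtain ⟨t, ht⟩ := hgp
  have hz : ∀ k : ℤ, a ^ k = 1 ↔ (p : ℤ) ^ n ∣ k := fun k => by
    rw [← orderOf_dvd_iff_zpow_eq_one, ha]
    push_cast
    rfl
  replace hr : g * a * g⁻¹ = a ^ r := hr.symm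
  replace ht : g ^ p = a ^ t := ht.symm
  have h₁ : (p : ℤ) ^ n ∣ ((r : ℤ) - 1) * t := by
    rw [← hz, sub_mul, one_mul, zpow_sub, zpow_mul, zpow_natCast, ← hr, conj_zpow, ← ht]
    group
  have h₂ : ¬ (p : ℤ) ^ n ∣ (r : ℤ) - 1 := by
    rw [← hz, zpow_sub, zpow_natCast, zpow_one, mul_inv_eq_one, ← hr, mul_inv_eq_iff_eq_mul]
    exact hga
  have h₃ : ∀ i : ℤ, ¬ (p : ℤ) ^ n ∣ i * (∑ j ∈ Finset.range p, (r : ℤ) ^ j) + t := fun i hi => by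
    rw [← hz, zpow_add, ← ht, ← mul_pow_of_conj hr] at hi
    refine hg ((mul_mem_cancel_left (zpow_mem (mem_zpowers a) i)).1 ?_)
    exact hZa (hZ.mem_of_pow_eq_one hi)
  obtain ⟨rfl, h₄, h₅⟩ := eq_two_of_norm_ne hp.out h₁ h₂ h₃
  refine ⟨rfl, ?_, hZ.mem_of_pow_eq_one ?_, ?_⟩
  · rw [← hz, zpow_add, zpow_natCast, zpow_one] at h₄
    rw [hr]
    exact eq_inv_of_mul_eq_one_left h₄
  · rw [ht, ← zpow_natCast, ← zpow_mul, hz, mul_comm]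
    exact_mod_cast h₅
  · rw [ht, Ne, hz]
    simpa using h₃ 0

omit hp [Finite P] in
/-- For normal `A`, this is an element of order `p` in the subgroup of `P/A` generated by `hA`. -/
theorem exists_pow_pow_not_mem (hP : IsPGroup p P) {A : Subgroup P} {h : P} (hh : h ∉ A) :
    ∃ j : ℕ, h ^ p ^ j ∉ A ∧ (h ^ p ^ j) ^ p ∈ A := by
  classical
  have hex : ∃ j : ℕ, h ^ p ^ j ∈ A := by
    obtain ⟨j, hj⟩ := hP h
    exact ⟨j, hj ▸ one_mem A⟩
  obtain ⟨j, hj⟩ : ∃ j, Nat.find hex = j + 1 :=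
    Nat.exists_eq_succ_of_ne_zero fun h0 => hh (by simpa [h0] using Nat.find_spec hex)
  refine ⟨j, Nat.find_min hex (by omega), ?_⟩
  rw [← pow_mul, ← pow_succ, ← hj]
  exact Nat.find_spec hex

/-- A maximal normal cyclic subgroup is self-centralizing. -/
theorem IsSocle.mem_of_commute (hP : IsPGroup p P) (hZ : IsSocle p Z) {a : P}
    (hZa : Z ≤ zpowers a) (hnorm : (zpowers a).Normal)
    (hmax : ∀ b : P, (zpowers b).Normal → zpowers a ≤ zpowers b → zpowers b ≤ zpowers a)
    {g : P} (hg : Commute g a) : g ∈ zpowers a := by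
  by_contra hga
  let C := centralizer (zpowers a : Set P)
  let D := C.map (QuotientGroup.mk' (zpowers a))
  have hD : D.Normal := Normal.map inferInstance _ (QuotientGroup.mk'_surjective _)
  have hgC : g ∈ C := mem_centralizer_iff.2 (by rintro _ ⟨k, rfl⟩; exact (hg.zpow_right k).symm.eq)
  -- `D` meets the centre of `P/⟨a⟩`, so it contains a central element `d⟨a⟩` of order `p`; then
  -- `⟨a, d⟩` is abelian with a unique subgroup of order `p`, which forces `⟨a⟩ < ⟨d⟩`
  have hDnt : Nontrivial D := by
    refine (nontrivial_iff_exists_ne_one D).2 ⟨g, mem_map_of_mem _ hgC, ?_⟩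
    exact fun h => hga ((QuotientGroup.eq_one_iff g).1 h)
  obtain ⟨x, hxD, hx1, hxc⟩ : ∃ x ∈ D, x ≠ 1 ∧ x ∈ center (P ⧸ zpowers a) := by
    have hQ : IsPGroup p (ConjAct (P ⧸ zpowers a)) := hP.to_quotient _
    obtain ⟨k, hk, hk'⟩ := (hP.to_quotient (zpowers a)).to_subgroup D |>.nontrivial_iff_card.1 hDnt
    obtain ⟨y, hy, hy1⟩ := hQ.exists_fixed_point_of_prime_dvd_card_of_fixed_point D
      (hk' ▸ dvd_pow_self p hk.ne') (a := 1) (fun q => smul_one q)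
    refine ⟨y, y.2, fun h => hy1 (Subtype.ext h.symm), mem_center_iff.2 fun q => ?_⟩
    have := congrArg Subtype.val (hy (ConjAct.toConjAct q))
    rw [ConjAct.Subgroup.val_conj_smul, ConjAct.smul_def, ConjAct.ofConjAct_toConjAct,
      mul_inv_eq_iff_eq_mul] at this
    exact this
  obtain ⟨c, hc, rfl⟩ := hxD
  have hc1 : c ∉ zpowers a := fun h => hx1 ((QuotientGroup.eq_one_iff c).2 h)
  obtain ⟨j, hj, hjp⟩ := exists_pow_pow_not_mem hP hc1
  have hcen : QuotientGroup.mk' (zpowers a) (c ^ p ^ j) ∈ center (P ⧸ zpowers a) := by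
    rw [map_pow]
    exact pow_mem hxc _
  replace hc : c ^ p ^ j ∈ C := pow_mem hc _
  generalize c ^ p ^ j = d at hj hjp hcen hc
  have hda : Commute d a := (mem_centralizer_iff.1 hc a (mem_zpowers a)).symm
  obtain ⟨t, ht⟩ := hjp
  replace ht : d ^ p = a ^ t := ht.symm
  by_cases hpt : (p : ℤ) ∣ t
  · obtain ⟨q, rfl⟩ := hpt
    refine hj ((mul_mem_cancel_left (zpow_mem (mem_zpowers a) (-q))).1 (hZa ?_))
    refine hZ.mem_of_pow_eq_one ?_
    rw [(hda.symm.zpow_left _).mul_pow, ht, ← zpow_natCast, ← zpow_mul, ← zpow_add]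
    simp [mul_comm]
  · have had : a ∈ zpowers d := by
      obtain ⟨m, hm⟩ := IsPGroup.iff_orderOf.1 hP a
      have hcop : IsCoprime ((p : ℤ) ^ m) t :=
        (((Nat.prime_iff_prime_int.1 hp.out).coprime_iff_not_dvd).2 hpt).pow_left
      obtain ⟨u, v, huv⟩ := hcop
      refine ⟨p * v, ?_⟩
      change d ^ ((p : ℤ) * v) = a
      rw [zpow_mul, zpow_natCast, ht, ← zpow_mul]
      have : a ^ (u * (p : ℤ) ^ m + v * t) = a := by rw [huv, zpow_one]
      rw [zpow_add, mul_comm u, zpow_mul] at this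
      rw [mul_comm t v]
      have h1 : a ^ ((p : ℤ) ^ m) = 1 := by
        rw [← Nat.cast_pow, zpow_natCast, ← hm, pow_orderOf_eq_one]
      rwa [h1, one_zpow, one_mul] at this
    have hle : zpowers a ≤ zpowers d := by simpa using had
    refine hj (hmax d ⟨fun x hx y => ?_⟩ hle (mem_zpowers d))
    have hz : QuotientGroup.mk' (zpowers a) x ∈ center (P ⧸ zpowers a) := by
      obtain ⟨k, rfl⟩ := hx
      change QuotientGroup.mk' (zpowers a) (d ^ k) ∈ _
      rw [map_zpow]
      exact zpow_mem hcen _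
    have h2 : QuotientGroup.mk' (zpowers a) (y * x * y⁻¹) = QuotientGroup.mk' (zpowers a) x := by
      rw [map_mul, map_mul, mem_center_iff.1 hz, map_inv, mul_inv_cancel_right]
    have h3 := hle (QuotientGroup.eq.1 h2)
    have h4 := mul_mem hx (inv_mem h3)
    simpa [mul_assoc] using h4

/-- A `p`-group with a unique subgroup of order `p` is cyclic, or `p = 2` and it has a cyclic
subgroup of index `2` outside which all elements have order `4`, as in a generalized quaternion
group. -/
theorem IsSocle.exists_zpowers (hP : IsPGroup p P) (hZ : IsSocle p Z) :
    ∃ a : P, Z ≤ zpowers a ∧ (zpowers a = ⊤ ∨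
      p = 2 ∧ (zpowers a).index = 2 ∧ ∀ g ∉ zpowers a, g ^ 2 ∈ Z ∧ g ^ 2 ≠ 1) := by
  obtain ⟨z, hz⟩ : ∃ z, zpowers z = Z := by
    have := isCyclic_of_prime_card hZ.card_eq
    obtain ⟨z, hz⟩ := IsCyclic.exists_generator (α := Z)
    refine ⟨z, le_antisymm (zpowers_le.2 z.2) fun x hx => ?_⟩
    obtain ⟨k, hk⟩ := hz ⟨x, hx⟩
    exact ⟨k, congrArg Subtype.val hk⟩
  obtain ⟨A, hA⟩ :=
    (Set.toFinite {A : Subgroup P | Z ≤ A ∧ A.Normal ∧ ∃ a, zpowers a = A}).exists_maximal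
      ⟨Z, le_rfl, hZ.normal, z, hz⟩
  obtain ⟨⟨hZa, hnorm, a, rfl⟩, hmax⟩ := hA
  refine ⟨a, hZa, or_iff_not_imp_left.2 fun htop => ?_⟩
  have hself : ∀ g, Commute g a → g ∈ zpowers a := fun g => hZ.mem_of_commute hP hZa hnorm
    fun b hb hab => hmax ⟨hZa.trans hab, hb, b, rfl⟩ hab
  obtain ⟨n, hn⟩ := IsPGroup.iff_orderOf.1 hP a
  have key : ∀ g ∉ zpowers a, g ^ p ∈ zpowers a →
      p = 2 ∧ g * a * g⁻¹ = a⁻¹ ∧ g ^ 2 ∈ Z ∧ g ^ 2 ≠ 1 := fun g hg hgp =>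
    hZ.eq_two_of_not_mem hn hZa hnorm hg (fun h => hg (hself g h)) hgp
  have hpow : ∀ h ∉ zpowers a, h ^ p ∈ zpowers a := by
    intro h hh
    obtain ⟨j, hj, hjp⟩ := exists_pow_pow_not_mem hP hh
    obtain ⟨h2, hinv, -⟩ := key _ hj hjp
    rcases j with _ | j
    · simpa using hjp
    -- `k²` inverts `⟨a⟩`, but `-1` is not a square modulo `4`
    exfalso
    rw [pow_succ, pow_mul] at hj hinv
    generalize h ^ p ^ j = k at hj hinv
    subst h2
    obtain ⟨r, hr⟩ := mem_powers_iff_mem_zpowers.2 (hnorm.conj_mem a (mem_zpowers a) k)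
    replace hr : k * a * k⁻¹ = a ^ r := hr.symm
    have hrr : k ^ 2 * a * (k ^ 2)⁻¹ = a ^ (r * r) := by
      rw [pow_mul, ← hr, conj_pow, ← hr, sq]
      group
    have h1 : a ^ (r * r + 1) = 1 := by
      rw [pow_succ, ← hrr, hinv, inv_mul_cancel]
    rw [← orderOf_dvd_iff_pow_eq_one, hn] at h1
    have hn2 : 2 ≤ n := by
      by_contra hlt
      have ha2 : a ^ 2 = 1 := by
        rw [← orderOf_dvd_iff_pow_eq_one, hn]
        exact pow_dvd_pow 2 (by omega : n ≤ 1)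
      have : a⁻¹ = a := inv_eq_of_mul_eq_one_left (by rw [← sq, ha2])
      rw [this, mul_inv_eq_iff_eq_mul] at hinv
      exact hj (hself _ hinv)
    have h4 : 4 ∣ r * r + 1 := (pow_dvd_pow 2 hn2).trans h1
    have : r % 4 < 4 := Nat.mod_lt _ (by norm_num)
    have h5 := Nat.mod_eq_zero_of_dvd h4
    rw [Nat.add_mod, Nat.mul_mod] at h5
    interval_cases r % 4 <;> simp at h5
  obtain ⟨h, hh⟩ : ∃ h, h ∉ zpowers a := by
    by_contra! hc
    exact htop (eq_top_iff.2 fun x _ => hc x)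
  refine ⟨(key h hh (hpow h hh)).1, index_eq_two_iff.2 ⟨h, fun b => ?_⟩,
    fun g hg => (key g hg (hpow g hg)).2.2⟩
  by_cases hb : b ∈ zpowers a
  · refine Or.inr ⟨hb, fun hc => hh ?_⟩
    exact (mul_mem_cancel_left hb).1 hc
  · refine Or.inl ⟨hself _ ?_, hb⟩
    have e₁ := (key h hh (hpow h hh)).2.1
    have e₂ := (key b hb (hpow b hb)).2.1
    rw [mul_inv_eq_iff_eq_mul] at e₁ e₂
    change b * h * a = a * (b * h)
    have e₃ : b * a⁻¹ = a * b := by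
      rw [mul_inv_eq_iff_eq_mul, mul_assoc, e₂, mul_inv_cancel_left]
    rw [mul_assoc, e₁, ← mul_assoc, e₃, mul_assoc]

/-- The socle is generated by a central element `z` of order `p`: together with an element of order
`p` outside `⟨z⟩`, it would generate an elementary abelian subgroup of order `p²`. -/
theorem exists_isSocle_of_pRank_eq_one (hP : IsPGroup p P) (h : pRank p P = 1) :
    ∃ Z : Subgroup P, IsSocle p Z := by
  have hbdd : BddAbove {n | ∃ E : Subgroup P, IsMulCommutative E ∧ (∀ x ∈ E, x ^ p = 1) ∧
      Nat.card E = p ^ n} := by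
    refine ⟨Nat.card P, ?_⟩
    rintro n ⟨E, -, -, hE⟩
    exact (Nat.lt_pow_self hp.out.one_lt).le.trans (hE ▸ card_le_card_group E)
  have hle : ∀ E : Subgroup P, IsMulCommutative E → (∀ x ∈ E, x ^ p = 1) → Nat.card E ≤ p := by
    intro E hE hEp
    obtain ⟨n, hn⟩ := IsPGroup.iff_card.1 (hP.to_subgroup E)
    have h1 : n ≤ 1 := h ▸ le_csSup hbdd ⟨E, hE, hEp, hn⟩
    rw [hn]
    exact (Nat.pow_le_pow_right hp.out.pos h1).trans (pow_one p).le
  have hnt : Nontrivial P := by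
    have hne : {n | ∃ E : Subgroup P, IsMulCommutative E ∧ (∀ x ∈ E, x ^ p = 1) ∧
      Nat.card E = p ^ n}.Nonempty := ⟨0, ⊥, inferInstance, by simp, by simp⟩
    have := Nat.sSup_mem hne hbdd
    rw [show sSup _ = 1 from h] at this
    obtain ⟨E, -, -, hE⟩ := this
    by_contra hnt
    rw [not_nontrivial_iff_subsingleton] at hnt
    have : Nat.card E = 1 := Nat.card_unique
    rw [this, pow_one] at hE
    exact hp.out.one_lt.ne hE
  have hcnt := hP.center_nontrivial
  obtain ⟨k, hk, hk'⟩ := (hP.to_subgroup (center P)).nontrivial_iff_card.1 hcnt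
  obtain ⟨z, hz⟩ := exists_prime_orderOf_dvd_card' p
    (hk' ▸ dvd_pow_self p hk.ne' : p ∣ Nat.card (center P))
  have hz' : orderOf (z : P) = p := by rw [orderOf_coe, hz]
  refine ⟨zpowers (z : P), by rw [Nat.card_zpowers, hz'], fun H hH => ?_⟩
  have hHnt : Nontrivial H := (nontrivial_iff_ne_bot H).2 hH
  obtain ⟨k, hk, hk'⟩ := (hP.to_subgroup H).nontrivial_iff_card.1 hHnt
  obtain ⟨x, hx⟩ := exists_prime_orderOf_dvd_card' p (hk' ▸ dvd_pow_self p hk.ne' : p ∣ Nat.card H)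
  have hx' : orderOf (x : P) = p := by rw [orderOf_coe, hx]
  have hxz : Commute (x : P) z := mem_center_iff.1 z.2 x
  let E := closure {(x : P), (z : P)}
  have hcomm : ∀ u ∈ ({(x : P), (z : P)} : Set P), ∀ v ∈ ({(x : P), (z : P)} : Set P),
      u * v = v * u := by
    rintro u (rfl | rfl) v (rfl | rfl)
    exacts [rfl, hxz, hxz.symm, rfl]
  have hE : IsMulCommutative E := isMulCommutative_closure hcomm
  have hEp : ∀ y ∈ E, y ^ p = 1 := by
    intro y hy
    induction hy using closure_induction with
    | mem y hy =>
      rcases hy with rfl | rfl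
      · rw [← hx', pow_orderOf_eq_one]
      · rw [← hz', pow_orderOf_eq_one]
    | one => exact one_pow p
    | mul u v hu hv hu' hv' =>
      have : Commute u v := congrArg Subtype.val (hE.is_comm.comm (⟨u, hu⟩ : E) ⟨v, hv⟩)
      rw [this.mul_pow, hu', hv', one_mul]
    | inv u hu hu' => rw [inv_pow, hu', inv_one]
  have hxE : zpowers (x : P) ≤ E := by
    rw [zpowers_le]; exact subset_closure (Or.inl rfl)
  have : zpowers (x : P) = E := eq_of_le_of_card_ge hxE (by
    rw [Nat.card_zpowers, hx']; exact hle E hE hEp)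
  rw [zpowers_le]
  have hzE : (z : P) ∈ E := subset_closure (Or.inr rfl)
  rw [← this] at hzE
  exact (zpowers_le.2 x.2) hzE

theorem exists_isSocle_of_isCyclic [IsCyclic P] [Nontrivial P] (hP : IsPGroup p P) :
    ∃ Z : Subgroup P, IsSocle p Z := by
  obtain ⟨k, hk, hk'⟩ := hP.nontrivial_iff_card.1 inferInstance
  obtain ⟨z, hz⟩ := exists_prime_orderOf_dvd_card' p (hk' ▸ dvd_pow_self p hk.ne' : p ∣ Nat.card P)
  refine ⟨zpowers z, by rw [Nat.card_zpowers, hz], fun H hH => ?_⟩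
  have hHnt : Nontrivial H := (nontrivial_iff_ne_bot H).2 hH
  obtain ⟨k, hk, hk'⟩ := (hP.to_subgroup H).nontrivial_iff_card.1 hHnt
  obtain ⟨x, hx⟩ := exists_prime_orderOf_dvd_card' p (hk' ▸ dvd_pow_self p hk.ne' : p ∣ Nat.card H)
  have hx' : orderOf (x : P) = p := by rw [orderOf_coe, hx]
  classical
  have := Fintype.ofFinite P
  -- a cyclic group has at most `p` elements of exponent `p`, and `zpowers z` consists of such
  have hsub : (zpowers z : Set P).toFinset ⊆ Finset.univ.filter fun y : P => y ^ p = 1 := by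
    intro y hy
    obtain ⟨m, rfl⟩ := Set.mem_toFinset.1 hy
    refine Finset.mem_filter.2 ⟨Finset.mem_univ _, ?_⟩
    change (z ^ m) ^ p = 1
    rw [← zpow_natCast, zpow_comm, zpow_natCast, ← hz, pow_orderOf_eq_one, one_zpow]
  have heq := Finset.eq_of_subset_of_card_le hsub (by
    refine (IsCyclic.card_pow_eq_one_le hp.out.pos).trans ?_
    rw [Set.toFinset_card, ← Nat.card_eq_fintype_card]
    exact (hz.symm.trans (Nat.card_zpowers z).symm).le)
  have hxz : (x : P) ∈ zpowers z := by
    rw [← SetLike.mem_coe, ← Set.mem_toFinset, heq, Finset.mem_filter]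
    exact ⟨Finset.mem_univ _, by rw [← hx', pow_orderOf_eq_one]⟩
  have : zpowers (x : P) = zpowers z := eq_of_le_of_card_ge (zpowers_le.2 hxz) (by
    rw [Nat.card_zpowers, Nat.card_zpowers, hx', hz])
  rw [← this, zpowers_le]
  exact x.2

end PGroups

/-! ### The size of a cyclic submodule on which the norm of the socle vanishes -/

section Dimension

open Subgroup Module

/-- If an irreducible polynomial `q` in `f` kills `v ≠ 0`, then `v, f v, …, f^(deg q - 1) v` are
linearly independent. -/
theorem natDegree_le_finrank_span {K V : Type*} [Field K] [AddCommGroup V] [Module K V]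
    [FiniteDimensional K V] {q : Polynomial K} (hq : Irreducible q) {f : Module.End K V} {v : V}
    (hv : v ≠ 0) (hqv : Polynomial.aeval f q v = 0) :
    q.natDegree ≤ finrank K (Submodule.span K (Set.range fun i : ℕ => (f ^ i) v)) := by
  let U := Submodule.span K (Set.range fun i : ℕ => (f ^ i) v)
  have hmem : ∀ r : Polynomial K, Polynomial.aeval f r v ∈ U := fun r => by
    rw [Polynomial.aeval_eq_sum_range, LinearMap.sum_apply]
    exact sum_mem fun i _ => Submodule.smul_mem _ _ (Submodule.subset_span ⟨i, rfl⟩)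
  let L : Polynomial.degreeLT K q.natDegree →ₗ[K] U :=
    LinearMap.codRestrict U ((LinearMap.applyₗ v) ∘ₗ (Polynomial.aeval f).toLinearMap ∘ₗ
      (Polynomial.degreeLT K q.natDegree).subtype) fun r => hmem r
  have hL : Function.Injective L := by
    rw [← LinearMap.ker_eq_bot, LinearMap.ker_eq_bot']
    rintro ⟨r, hr⟩ h
    have h : Polynomial.aeval f r v = 0 := congrArg Subtype.val h
    by_contra hne
    have hr0 : r ≠ 0 := fun h0 => hne (Subtype.ext h0)
    rw [Polynomial.mem_degreeLT] at hr
    have hnd : ¬ q ∣ r := fun hd => by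
      have := Polynomial.degree_le_of_dvd hd hr0
      rw [Polynomial.degree_eq_natDegree hq.ne_zero] at this
      exact absurd hr (not_lt.2 this)
    obtain ⟨u, w, huw⟩ := (hq.coprime_iff_not_dvd).2 hnd
    apply hv
    have := congrArg (fun t => Polynomial.aeval f t v) huw
    simpa [h, hqv] using this.symm
  have := LinearMap.finrank_le_finrank_of_injective hL
  rwa [(Polynomial.degreeLTEquiv K q.natDegree).finrank_eq, finrank_fin_fun] at this

variable {P V : Type*} [Group P] [AddCommGroup V] [Module ℚ V] [FiniteDimensional ℚ V]

/-- The norm of `⟨a^(p^m)⟩` is the value of the cyclotomic polynomial `Φ_{p^(m+1)}` at `a`. -/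
theorem totient_le_finrank_span_pow {p : ℕ} [hp : Fact p.Prime] (ρ : Representation ℚ P V) {a : P}
    {m : ℕ} (hN : ∑ i ∈ Finset.range p, ρ ((a ^ p ^ m) ^ i) = 0) {v : V} (hv : v ≠ 0) :
    p ^ m * (p - 1) ≤ finrank ℚ (Submodule.span ℚ (Set.range fun i : ℕ => ρ (a ^ i) v)) := by
  have hirr := Polynomial.cyclotomic.irreducible_rat (pow_pos hp.out.pos (m + 1))
  have h := natDegree_le_finrank_span (f := ρ a) hirr hv (by
    rw [Polynomial.cyclotomic_prime_pow_eq_geom_sum hp.out]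
    simp only [map_sum, map_pow, Polynomial.aeval_X] at hN ⊢
    rw [hN]; rfl)
  rw [Polynomial.natDegree_cyclotomic, Nat.totient_prime_pow_succ hp.out] at h
  have e : (fun i : ℕ => ρ (a ^ i) v) = fun i => (ρ a ^ i) v := by simp only [map_pow]
  rw [e]
  exact h

theorem exists_invariant_form [Finite P] (ρ : Representation ℚ P V) :
    ∃ B : LinearMap.BilinForm ℚ V, (∀ v w, B v w = B w v) ∧ (∀ v, B v v = 0 → v = 0) ∧
      ∀ g v w, B (ρ g v) (ρ g w) = B v w := by
  have := Fintype.ofFinite P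
  let b := finBasis ℚ V
  let B : LinearMap.BilinForm ℚ V := ∑ g : P, ∑ i,
    (LinearMap.mul ℚ ℚ).compl₁₂ (b.coord i ∘ₗ ρ g) (b.coord i ∘ₗ ρ g)
  have hB : ∀ v w, B v w = ∑ g : P, ∑ i, b.repr (ρ g v) i * b.repr (ρ g w) i := fun v w => by
    simp [B, LinearMap.sum_apply]
  refine ⟨B, fun v w => ?_, fun v hv => ?_, fun g v w => ?_⟩
  · simp only [hB, mul_comm]
  · rw [hB, Finset.sum_eq_zero_iff_of_nonneg
      fun g _ => Finset.sum_nonneg fun i _ => mul_self_nonneg _] at hv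
    have h := hv 1 (Finset.mem_univ _)
    rw [Finset.sum_eq_zero_iff_of_nonneg fun i _ => mul_self_nonneg _] at h
    refine b.repr.map_eq_zero_iff.1 (Finsupp.ext fun i => ?_)
    simpa using h i (Finset.mem_univ _)
  · rw [hB, hB]
    refine Fintype.sum_equiv (Equiv.mulRight g) _ _ fun x => ?_
    simp

variable [Finite P] {p : ℕ} [hp : Fact p.Prime]

/-- The lower bound `|P| - |P|/p` for the dimension of a cyclic submodule on which the norm of the
socle `⟨a^(p^m)⟩` vanishes, multiplied by `p`. -/
theorem card_le_finrank_span_orbit (ρ : Representation ℚ P V) {a : P} {m : ℕ}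
    (ha : orderOf a = p ^ (m + 1))
    (hcase : zpowers a = ⊤ ∨ p = 2 ∧ (zpowers a).index = 2 ∧ ∀ g ∉ zpowers a, g ^ 2 = a ^ p ^ m)
    (hN : ∑ i ∈ Finset.range p, ρ ((a ^ p ^ m) ^ i) = 0) {v : V} (hv : v ≠ 0) :
    (p - 1) * Nat.card P ≤ p * finrank ℚ (Submodule.span ℚ (Set.range fun g : P => ρ g v)) := by
  have hdim := totient_le_finrank_span_pow ρ hN hv
  set U := Submodule.span ℚ (Set.range fun i : ℕ => ρ (a ^ i) v) with hU
  set X := Submodule.span ℚ (Set.range fun g : P => ρ g v) with hX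
  have hUX : U ≤ X := Submodule.span_mono (by rintro _ ⟨i, rfl⟩; exact ⟨a ^ i, rfl⟩)
  rcases hcase with htop | ⟨rfl, hidx, hsq⟩
  · have hcard : Nat.card P = p ^ (m + 1) := by rw [← ha, ← Nat.card_zpowers, htop, card_top]
    rw [hcard, pow_succ]
    calc (p - 1) * (p ^ m * p) = p * (p ^ m * (p - 1)) := by ring
      _ ≤ _ := Nat.mul_le_mul_left _ (hdim.trans (Submodule.finrank_mono hUX))
  · obtain ⟨B, hsymm, hpos, hinv⟩ := exists_invariant_form ρ
    have hcard : Nat.card P = 2 ^ (m + 1) * 2 := by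
      rw [← (zpowers a).card_mul_index, hidx, Nat.card_zpowers, ha]
    obtain ⟨y, hy⟩ : ∃ y, y ∉ zpowers a := by
      by_contra! h
      rw [(eq_top_iff' _).2 h, index_top] at hidx
      norm_num at hidx
    -- `g` is an isometry with `g² = -1`, so `⟨w, g w⟩ = ⟨g w, g² w⟩ = -⟨w, g w⟩`
    have horth : ∀ g ∉ zpowers a, ∀ w, B w (ρ g w) = 0 := fun g hg w => by
      have hneg : ρ (g ^ 2) w = -w := by
        have := LinearMap.congr_fun hN w
        rw [Finset.sum_range_succ, Finset.sum_range_one, pow_zero, pow_one, map_one] at this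
        rw [hsq g hg]
        exact eq_neg_of_add_eq_zero_right this
      have h := hinv g w (ρ g w)
      rw [← Module.End.mul_apply, ← map_mul, ← sq, hneg, map_neg, hsymm] at h
      linarith
    have hperp : ∀ u ∈ U, ∀ w ∈ U, B u (ρ y w) = 0 := by
      intro u hu w hw
      induction hu using Submodule.span_induction with
      | zero => simp
      | add u u' _ _ hu hu' => simp [hu, hu']
      | smul c u _ hu => simp [hu]
      | mem u hu =>
        obtain ⟨i, rfl⟩ := hu
        induction hw using Submodule.span_induction with
        | zero => simp
        | add u u' _ _ hu hu' => simp only [map_add, hu, hu', add_zero]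
        | smul c u _ hu => simp only [map_smul, hu, smul_zero]
        | mem w hw =>
          obtain ⟨j, rfl⟩ := hw
          change B (ρ (a ^ i) v) (ρ y (ρ (a ^ j) v)) = 0
          rw [← hinv (a ^ i)⁻¹, ← Module.End.mul_apply, ← Module.End.mul_apply,
            ← Module.End.mul_apply, ← map_mul, ← map_mul, ← map_mul, inv_mul_cancel, map_one]
          refine horth _ (fun h => hy ?_) v
          have h1 := pow_mem (mem_zpowers a) i
          have h2 := pow_mem (mem_zpowers a) j
          have := mul_mem (mul_mem h1 h) (inv_mem h2)
          simpa [mul_assoc] using this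
    have hdisj : U ⊓ U.map (ρ y) = ⊥ := by
      refine (Submodule.eq_bot_iff _).2 ?_
      rintro _ ⟨hu, w, hw, rfl⟩
      exact hpos _ (hperp _ hu w hw)
    have hsup : U ⊔ U.map (ρ y) ≤ X := by
      refine sup_le hUX ?_
      rw [hU, Submodule.map_span, Submodule.span_le]
      rintro _ ⟨_, ⟨i, rfl⟩, rfl⟩
      refine Submodule.subset_span ⟨y * a ^ i, ?_⟩
      simp
    have h1 := Submodule.finrank_sup_add_finrank_inf_eq U (U.map (ρ y))
    have h2 : finrank ℚ (U.map (ρ y)) = finrank ℚ U :=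
      (Submodule.equivMapOfInjective (ρ y) (ρ.apply_bijective y).1 U).finrank_eq.symm
    rw [hdisj, finrank_bot, h2] at h1
    have h3 := Submodule.finrank_mono hsup
    rw [hcard, pow_succ]
    simp at hdim
    omega

end Dimension

/-! ### Splitting off the representations that are faithful on the socle -/

section GrothendieckGroup

open Subgroup Module CategoryTheory Representation

variable {G : Type u} [Group G]

theorem RQ.mk_of_surjective {V W : Rep.{u} ℚ G} (f : V ⟶ W) (hf : Function.Surjective f.hom)
    (hV : Module.Finite ℚ V) (hW : Module.Finite ℚ W) :
    ∃ (h : ∀ g, LinearMap.ker f.hom.toLinearMap ≤ (LinearMap.ker f.hom.toLinearMap).comap (V.ρ g)),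
      RQ.mk V hV = RQ.mk (V.subrepresentation (LinearMap.ker f.hom.toLinearMap) h)
        (inferInstanceAs (Module.Finite ℚ (LinearMap.ker f.hom.toLinearMap))) + RQ.mk W hW := by
  have h : ∀ g, LinearMap.ker f.hom.toLinearMap ≤
      (LinearMap.ker f.hom.toLinearMap).comap (V.ρ g) := fun g v hv => by
    change f.hom (V.ρ g v) = 0
    rw [Rep.hom_comm_apply, show f.hom v = 0 from hv, map_zero]
  refine ⟨h, RQ.mk_shortExact (ShortComplex.mk (V.subtype (LinearMap.ker f.hom.toLinearMap) h) f
    (by ext x; exact x.2)) ?_ _ _ _⟩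
  exact
    { exact := (forget₂ (Rep.{u} ℚ G) (ModuleCat ℚ)).reflects_exact_of_faithful _ <|
        (ShortComplex.moduleCat_exact_iff _).2 fun x hx =>
          ⟨(⟨x, hx⟩ : LinearMap.ker f.hom.toLinearMap), rfl⟩
      mono_f := (Rep.mono_iff_injective _).2 fun _ _ h => Subtype.ext h
      epi_g := (Rep.epi_iff_surjective _).2 hf }

theorem RQ.mk_eq_add_quotient (V : Rep.{u} ℚ G) (hV : Module.Finite ℚ V) (W : Submodule ℚ V)
    (hW : ∀ g, W ≤ W.comap (V.ρ g)) :
    RQ.mk V hV = RQ.mk (V.subrepresentation W hW) (inferInstanceAs (Module.Finite ℚ W)) +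
      RQ.mk (V.quotient W hW) (inferInstanceAs (Module.Finite ℚ (V ⧸ W))) := by
  refine RQ.mk_shortExact (ShortComplex.mk (V.subtype W hW) (V.mkQ W hW)
    (by ext x; exact (Submodule.Quotient.mk_eq_zero _).2 x.2)) ?_ _ _ _
  exact
    { exact := (forget₂ (Rep.{u} ℚ G) (ModuleCat ℚ)).reflects_exact_of_faithful _ <|
        (ShortComplex.moduleCat_exact_iff _).2 fun x hx =>
          ⟨(⟨x, (Submodule.Quotient.mk_eq_zero _).1 hx⟩ : W), rfl⟩
      mono_f := (Rep.mono_iff_injective _).2 fun _ _ h => Subtype.ext h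
      epi_g := (Rep.epi_iff_surjective _).2 (Submodule.mkQ_surjective _) }

theorem RQ.mk_eq_zero (V : Rep.{u} ℚ G) (hV : Module.Finite ℚ V) [Subsingleton V] :
    RQ.mk V hV = 0 := by
  have h := RQ.mk_eq_add_quotient V hV ⊥ fun g => bot_le
  have hz : ∀ X : Rep.{u} ℚ G, Subsingleton X → Limits.IsZero X := fun X hX =>
    (Rep.isZero_iff (k := ℚ) (M := X) (G := G)).2 hX
  have e₁ := RQ.mk_eq_of_iso ((hz (V.subrepresentation ⊥ fun g => bot_le)
    (inferInstanceAs (Subsingleton (⊥ : Submodule ℚ V)))).iso (hz V inferInstance))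
    (inferInstanceAs (Module.Finite ℚ (⊥ : Submodule ℚ V))) hV
  have e₂ := RQ.mk_eq_of_iso ((hz (V.quotient ⊥ fun g => bot_le)
    (inferInstanceAs (Subsingleton (V ⧸ (⊥ : Submodule ℚ V))))).iso (hz V inferInstance))
    (inferInstanceAs (Module.Finite ℚ (V ⧸ (⊥ : Submodule ℚ V)))) hV
  rw [e₁, e₂] at h
  exact left_eq_add.1 h

/-- The rank homomorphism `R_ℚ(G) → ℤ`, `[V] ↦ dim V`. -/
noncomputable def RQ.dim (G : Type u) [Group G] : RQ G →+ ℤ :=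
  RQ.lift (fun V => (finrank ℚ V.1 : ℤ)) fun S h₁ h₂ h₃ hS => by
    have hS' := (hS.map_of_exact (forget₂ (Rep.{u} ℚ G) (ModuleCat ℚ)))
    have : Module.Finite ℚ (S.map (forget₂ (Rep.{u} ℚ G) (ModuleCat ℚ))).X₁ := h₁
    have : Module.Finite ℚ (S.map (forget₂ (Rep.{u} ℚ G) (ModuleCat ℚ))).X₃ := h₃
    exact_mod_cast ModuleCat.free_shortExact_finrank_add
      (S := S.map (forget₂ (Rep.{u} ℚ G) (ModuleCat ℚ))) hS' rfl rfl

theorem RQ.dim_mk (V : Rep.{u} ℚ G) (hV : Module.Finite ℚ V) :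
    RQ.dim G (RQ.mk V hV) = finrank ℚ V :=
  RQ.lift_mk _ _ V hV

theorem RQ.dim_res {H : Type u} [Group H] (φ : G →* H) (x : RQ H) :
    RQ.dim G (RQ.res φ x) = RQ.dim H x := by
  suffices (RQ.dim G).comp (RQ.res φ) = RQ.dim H from DFunLike.congr_fun this x
  refine RQ.hom_ext fun V hV => ?_
  rw [AddMonoidHom.comp_apply, RQ.res_mk, RQ.dim_mk, RQ.dim_mk]

variable [Finite G]

theorem RQ.dim_permClass (H : Subgroup G) : RQ.dim G (permClass H) = H.index := by
  rw [permClass, RQ.dim_mk]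
  have := Fintype.ofFinite (G ⧸ H)
  have : finrank ℚ (MonoidAlgebra ℚ (G ⧸ H)) = Nat.card (G ⧸ H) := by
    rw [(MonoidAlgebra.coeffLinearEquiv ℚ).finrank_eq, finrank_finsupp_self,
      Nat.card_eq_fintype_card]
  exact_mod_cast this

theorem RQ.mk_leftRegular : RQ.mk (Rep.leftRegular ℚ G)
    (inferInstanceAs (Module.Finite ℚ (MonoidAlgebra ℚ G))) = permClass ⊥ := by
  let e : G ≃ G ⧸ (⊥ : Subgroup G) := (QuotientGroup.quotientBot (G := G)).symm.toEquiv
  have he : ∀ x y : G, e (x • y) = x • e y := fun x y => rfl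
  exact RQ.mk_eq_of_iso (Rep.mkIso (Representation.Equiv.mk
    (MonoidAlgebra.mapDomainLinearEquiv ℚ ℚ e) fun x => by
      ext y a
      simp only [LinearMap.coe_comp, Function.comp_apply, LinearEquiv.coe_coe,
        MonoidAlgebra.lsingle_apply, Representation.ofMulAction_single,
        MonoidAlgebra.mapDomainLinearEquiv_single, he])) _ _

end GrothendieckGroup

section Faithful

open Subgroup Module CategoryTheory Representation

variable {P Q : Type u} [Group P] [Group Q]

/-- A representation on which `ker π` acts trivially is inflated along `π`. -/
theorem RQ.exists_res_eq (π : P →* Q) (hπ : Function.Surjective π) (V : Rep.{u} ℚ P)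
    (hV : Module.Finite ℚ V) (hker : ∀ g, π g = 1 → V.ρ g = 1) :
    ∃ y, RQ.res π y = RQ.mk V hV := by
  have key : ∀ g h, π g = π h → V.ρ g = V.ρ h := fun g h hgh => by
    have := hker (g * h⁻¹) (by simp [hgh])
    have e : g = g * h⁻¹ * h := by simp
    rw [e, map_mul, this, one_mul]
  let σ := Function.surjInv hπ
  have hσ : ∀ q, π (σ q) = q := Function.surjInv_eq hπ
  let τ : Representation ℚ Q V :=
    { toFun := fun q => V.ρ (σ q)
      map_one' := (key _ 1 (by rw [hσ, map_one])).trans (map_one _)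
      map_mul' := fun q r =>
        (key _ (σ q * σ r) (by rw [map_mul, hσ, hσ, hσ])).trans (map_mul _ _ _) }
  refine ⟨RQ.mk (Rep.of τ) hV, ?_⟩
  rw [RQ.res_mk]
  refine RQ.mk_eq_of_iso (Rep.mkIso (ρ := τ.comp π) (σ := V.ρ) (Representation.Equiv.mk
    (LinearEquiv.refl ℚ V) fun g => ?_)) _ _
  exact key _ g (hσ _)

variable {p : ℕ} {z : P} {π : P →* Q}

theorem sum_pow_mul_eq (V : Rep.{u} ℚ P) (hz : z ^ p = 1) :
    (∑ i ∈ Finset.range p, V.ρ (z ^ i)) * V.ρ z = ∑ i ∈ Finset.range p, V.ρ (z ^ i) := by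
  have h := Finset.sum_range_succ (fun i => V.ρ (z ^ i)) p
  rw [Finset.sum_range_succ', hz, pow_zero] at h
  rw [Finset.sum_mul, ← add_right_cancel h]
  simp [pow_succ]

variable [Finite P]

/-- Up to inflated classes, every class is that of a representation killed by the norm of `⟨z⟩`,
namely the kernel of that norm. -/
theorem RQ.exists_eq_res_add (hπ : Function.Surjective π) (hker : π.ker = zpowers z)
    (hz : z ^ p = 1) (hcen : z ∈ center P) (V : Rep.{u} ℚ P) (hV : Module.Finite ℚ V) :
    ∃ (y : RQ Q) (V' : Rep.{u} ℚ P) (hV' : Module.Finite ℚ V'),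
      ∑ i ∈ Finset.range p, V'.ρ (z ^ i) = 0 ∧ RQ.mk V hV = RQ.res π y + RQ.mk V' hV' := by
  let N : Module.End ℚ V := ∑ i ∈ Finset.range p, V.ρ (z ^ i)
  have hN : ∀ g, N * V.ρ g = V.ρ g * N := fun g => by
    rw [Finset.sum_mul, Finset.mul_sum]
    refine Finset.sum_congr rfl fun i _ => ?_
    rw [← map_mul, ← map_mul, mem_center_iff.1 (pow_mem hcen i) g]
  have hK : ∀ g, LinearMap.ker N ≤ (LinearMap.ker N).comap (V.ρ g) := fun g v hv => by
    change N (V.ρ g v) = 0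
    rw [← Module.End.mul_apply, hN, Module.End.mul_apply, show N v = 0 from hv, map_zero]
  obtain ⟨y, hy⟩ := RQ.exists_res_eq π hπ (V.quotient (LinearMap.ker N) hK)
    (inferInstanceAs (Module.Finite ℚ (V ⧸ LinearMap.ker N))) (by
      have h1 : (V.quotient (LinearMap.ker N) hK).ρ z = 1 := by
        ext v
        refine (Submodule.Quotient.eq _).2 ?_
        change N (V.ρ z v - v) = 0
        rw [map_sub, ← Module.End.mul_apply, sum_pow_mul_eq V hz, sub_self]
      intro g hg
      have hg : g ∈ zpowers z := hker ▸ hg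
      obtain ⟨k, rfl⟩ := mem_powers_iff_mem_zpowers.2 hg
      exact (map_pow _ z k).trans (by rw [h1, one_pow]))
  refine ⟨y, V.subrepresentation (LinearMap.ker N) hK,
    inferInstanceAs (Module.Finite ℚ (LinearMap.ker N)), ?_, ?_⟩
  · ext v
    have hv : N v = 0 := v.2
    rw [LinearMap.sum_apply] at hv ⊢
    exact (map_sum (LinearMap.ker N).subtype _ _).trans hv
  · rw [hy, add_comm]
    exact RQ.mk_eq_add_quotient V hV _ hK

variable [Finite Q]

/-- The norm of `⟨z⟩` acts on the coinvariants as multiplication by `p`, so they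
vanish if it is zero. -/
theorem RQ.ind_eq_zero (hp : p ≠ 0) (hz : π z = 1) (V : Rep.{u} ℚ P) (hV : Module.Finite ℚ V)
    (hN : ∑ i ∈ Finset.range p, V.ρ (z ^ i) = 0) : RQ.ind π (RQ.mk V hV) = 0 := by
  rw [RQ.ind_mk]
  have key : ∀ h v, IndV.mk π V.ρ h v = 0 := fun h v => by
    have h1 : ∀ i : ℕ, IndV.mk π V.ρ h (V.ρ (z ^ i) v) = IndV.mk π V.ρ h v := fun i => by
      have := indV_mk_map π V.ρ (z ^ i) h v
      rwa [map_pow, hz, one_pow, one_mul] at this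
    have h2 := congrArg (IndV.mk π V.ρ h) (LinearMap.congr_fun hN v)
    rw [LinearMap.sum_apply, map_sum, Finset.sum_congr rfl fun i _ => h1 i, Finset.sum_const,
      Finset.card_range, LinearMap.zero_apply, map_zero] at h2
    have h3 : (p : ℚ) • IndV.mk π V.ρ h v = 0 := by rw [Nat.cast_smul_eq_nsmul]; exact h2
    exact (smul_eq_zero.1 h3).resolve_left (Nat.cast_ne_zero.2 hp)
  have : Subsingleton (Rep.ind π V) := by
    refine subsingleton_of_forall_eq 0 fun x => ?_
    have := mem_span_indV_mk π V.ρ x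
    have h0 : (Set.range fun y : Q × V => IndV.mk π V.ρ y.1 y.2) ⊆ {0} := by
      rintro _ ⟨y, rfl⟩
      exact key _ _
    have := Submodule.span_mono h0 this
    simpa using this
  exact RQ.mk_eq_zero _ _

variable (π) in
/-- The class `[ℚP] - Inf [ℚQ]` of the kernel of `ℚP → ℚQ`. -/
noncomputable def faithfulClass : RQ P := permClass ⊥ - RQ.res π (permClass ⊥)

theorem ind_faithfulClass (hπ : Function.Surjective π) : RQ.ind π (faithfulClass π) = 0 := by
  have h := DFunLike.congr_fun (RQ.ind_comp_res_of_surjective π hπ) (permClass ⊥)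
  rw [AddMonoidHom.comp_apply, AddMonoidHom.id_apply] at h
  rw [faithfulClass, map_sub, h, RQ.ind_permClass, Subgroup.map_bot, sub_self]

theorem dim_faithfulClass : RQ.dim P (faithfulClass π) = Nat.card P - Nat.card Q := by
  rw [faithfulClass, map_sub, RQ.dim_res, RQ.dim_permClass, RQ.dim_permClass, index_bot, index_bot]

/-- If the norm `1 + z + ⋯ + z^(p-1)` vanishes on `V`, then each non-zero cyclic submodule of `V`
has dimension at least `|P| - |P|/p`. -/
def OrbitSpansLarge (p : ℕ) (z : P) : Prop :=
  ∀ (V : Rep.{u} ℚ P) (_ : Module.Finite ℚ V), ∑ i ∈ Finset.range p, V.ρ (z ^ i) = 0 →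
    ∀ v : V, v ≠ 0 → (p - 1) * Nat.card P ≤
      p * finrank ℚ (Submodule.span ℚ (Set.range fun g : P => V.ρ g v))

omit [Finite P] in
theorem span_orbit_le_comap (V : Rep.{u} ℚ P) (v : V) (g : P) :
    Submodule.span ℚ (Set.range fun g : P => V.ρ g v) ≤
      (Submodule.span ℚ (Set.range fun g : P => V.ρ g v)).comap (V.ρ g) := by
  rw [Submodule.span_le]
  rintro _ ⟨h, rfl⟩
  refine Submodule.subset_span ⟨g * h, ?_⟩
  simp

/-- A non-zero cyclic submodule `ℚP v` killed by the norm of `⟨z⟩` has class `faithfulClass π`. The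
kernel of `ℚP → ℚP v` is `Inf y` plus a representation `K` killed by the norm; taking coinvariants
gives `y = [ℚQ]`, and then the dimension bound leaves no room for `K`. -/
theorem mk_span_orbit (hp : p.Prime) (hπ : Function.Surjective π) (hker : π.ker = zpowers z)
    (hz : z ^ p = 1) (hcen : z ∈ center P) (hcard : Nat.card P = p * Nat.card Q)
    (hlarge : OrbitSpansLarge p z) (V : Rep.{u} ℚ P) (hV : Module.Finite ℚ V)
    (hN : ∑ i ∈ Finset.range p, V.ρ (z ^ i) = 0) {v : V} (hv : v ≠ 0) :
    RQ.mk (V.subrepresentation _ (span_orbit_le_comap V v)) (inferInstanceAs (Module.Finite ℚ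
      (Submodule.span ℚ (Set.range fun g : P => V.ρ g v)))) = faithfulClass π := by
  have hzπ : π z = 1 := by
    rw [← MonoidHom.mem_ker, hker]
    exact mem_zpowers z
  set X := Submodule.span ℚ (Set.range fun g : P => V.ρ g v) with hX
  let U := V.subrepresentation X (span_orbit_le_comap V v)
  have hU : Module.Finite ℚ U := inferInstanceAs (Module.Finite ℚ X)
  let f : Rep.leftRegular ℚ P ⟶ U :=
    Rep.leftRegularHom U ⟨v, Submodule.subset_span ⟨1, by simp⟩⟩
  have hf : Function.Surjective f.hom := by
    rintro ⟨x, hx⟩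
    have : X ≤ (LinearMap.range f.hom.toLinearMap).map X.subtype := by
      refine Submodule.span_le.2 ?_
      rintro _ ⟨g, rfl⟩
      refine ⟨_, ⟨MonoidAlgebra.single g 1, rfl⟩, ?_⟩
      change X.subtype (f.hom _) = _
      rw [Rep.leftRegularHom_hom_single, one_smul]
      rfl
    obtain ⟨_, ⟨y, rfl⟩, hy⟩ := this hx
    exact ⟨y, Subtype.ext hy⟩
  obtain ⟨hK, h₁⟩ := RQ.mk_of_surjective f hf
    (inferInstanceAs (Module.Finite ℚ (MonoidAlgebra ℚ P))) hU
  rw [RQ.mk_leftRegular] at h₁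
  obtain ⟨y, K, hKf, hKN, hK'⟩ := RQ.exists_eq_res_add hπ hker hz hcen
    ((Rep.leftRegular ℚ P).subrepresentation _ hK) (inferInstanceAs
      (Module.Finite ℚ (LinearMap.ker f.hom.toLinearMap)))
  rw [hK'] at h₁
  have hUN : ∑ i ∈ Finset.range p, U.ρ (z ^ i) = 0 := by
    ext x
    have hx := LinearMap.congr_fun hN x
    rw [LinearMap.sum_apply] at hx ⊢
    exact (map_sum X.subtype _ _).trans hx
  have hy : permClass ⊥ = y := by
    have h₂ := congrArg (RQ.ind π) h₁
    have h₃ := DFunLike.congr_fun (RQ.ind_comp_res_of_surjective π hπ) y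
    rw [AddMonoidHom.comp_apply, AddMonoidHom.id_apply] at h₃
    rwa [map_add, map_add, h₃, RQ.ind_eq_zero hp.ne_zero hzπ K hKf hKN,
      RQ.ind_eq_zero hp.ne_zero hzπ U hU hUN, RQ.ind_permClass, Subgroup.map_bot, add_zero,
      add_zero] at h₂
  have hdim := congrArg (RQ.dim P) h₁
  rw [map_add, map_add, RQ.dim_res, ← hy, RQ.dim_permClass, RQ.dim_permClass, index_bot,
    index_bot, RQ.dim_mk, RQ.dim_mk] at hdim
  have hle : (p - 1) * Nat.card P ≤ p * finrank ℚ U := hlarge V hV hN v hv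
  have hle' : (p - 1) * Nat.card Q ≤ finrank ℚ U := by
    rw [hcard, mul_left_comm] at hle
    exact Nat.le_of_mul_le_mul_left hle hp.pos
  have hK0 : finrank ℚ K = 0 := by
    have h₄ : (p - 1) * Nat.card Q + Nat.card Q = p * Nat.card Q := by
      rw [← Nat.succ_mul, Nat.succ_eq_add_one, Nat.sub_add_cancel hp.one_le]
    have h₅ : Nat.card P = Nat.card Q + finrank ℚ K + finrank ℚ U := by exact_mod_cast hdim
    omega
  have : Subsingleton K := finrank_zero_iff.1 hK0
  rw [RQ.mk_eq_zero K hKf, add_zero, ← hy] at h₁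
  rw [faithfulClass, h₁, add_sub_cancel_left]

theorem exists_mk_eq_smul (hp : p.Prime) (hπ : Function.Surjective π) (hker : π.ker = zpowers z)
    (hz : z ^ p = 1) (hcen : z ∈ center P) (hcard : Nat.card P = p * Nat.card Q)
    (hlarge : OrbitSpansLarge p z) (n : ℕ) : ∀ (V : Rep.{u} ℚ P) (hV : Module.Finite ℚ V),
    ∑ i ∈ Finset.range p, V.ρ (z ^ i) = 0 → finrank ℚ V = n →
      ∃ k : ℤ, RQ.mk V hV = k • faithfulClass π := by
  induction n using Nat.strong_induction_on with
  | _ n ih =>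
    intro V hV hN hn
    rcases subsingleton_or_nontrivial V with hs | hs
    · exact ⟨0, by rw [RQ.mk_eq_zero V hV, zero_smul]⟩
    obtain ⟨v, hv⟩ := exists_ne (0 : V)
    have h₁ := RQ.mk_eq_add_quotient V hV _ (span_orbit_le_comap V v)
    rw [mk_span_orbit hp hπ hker hz hcen hcard hlarge V hV hN hv] at h₁
    obtain ⟨k, hk⟩ := ih (finrank ℚ (V ⧸ Submodule.span ℚ (Set.range fun g : P => V.ρ g v))) (by
        have h₂ := Submodule.finrank_quotient_add_finrank
          (Submodule.span ℚ (Set.range fun g : P => V.ρ g v))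
        have h₃ : 0 < finrank ℚ (Submodule.span ℚ (Set.range fun g : P => V.ρ g v)) :=
          Submodule.one_le_finrank_iff.2 fun h => hv
            ((Submodule.eq_bot_iff _).1 h v (Submodule.subset_span ⟨1, by simp⟩))
        omega) (V.quotient _ (span_orbit_le_comap V v)) (inferInstanceAs (Module.Finite ℚ (V ⧸ _)))
      (by
        refine LinearMap.ext fun x => ?_
        obtain ⟨x, rfl⟩ := Submodule.mkQ_surjective _ x
        have hx := LinearMap.congr_fun hN x
        rw [LinearMap.sum_apply] at hx ⊢
        have := congrArg (Submodule.mkQ (Submodule.span ℚ (Set.range fun g : P => V.ρ g v))) hx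
        rw [map_sum] at this
        exact this) rfl
    refine ⟨1 + k, ?_⟩
    rw [h₁, hk, add_smul, one_smul]

/-- The decomposition `R_ℚ(P) = Inf R_ℚ(Q) ⊕ ℤ s` with `s = faithfulClass π`, expressed by the
coordinate `m` of `s`; the other projection is `RQ.ind π`, that is, taking coinvariants. -/
theorem exists_faithful_multiplicity (hp : p.Prime) (hπ : Function.Surjective π)
    (hker : π.ker = zpowers z) (hz : z ^ p = 1) (hcen : z ∈ center P)
    (hcard : Nat.card P = p * Nat.card Q) (hlarge : OrbitSpansLarge p z) :
    ∃ m : RQ P →+ ℤ, m (faithfulClass π) = 1 ∧ (∀ y, m (RQ.res π y) = 0) ∧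
      ∀ x, x = RQ.res π (RQ.ind π x) + m x • faithfulClass π := by
  have hret : ∀ y, RQ.ind π (RQ.res π y) = y :=
    DFunLike.congr_fun (RQ.ind_comp_res_of_surjective π hπ)
  have hzπ : π z = 1 := by
    rw [← MonoidHom.mem_ker, hker]
    exact mem_zpowers z
  let e : RQ P →+ RQ P := AddMonoidHom.id _ - (RQ.res π).comp (RQ.ind π)
  have he : ∀ x, e x = x - RQ.res π (RQ.ind π x) := fun x => rfl
  have hmem : ∀ x, e x ∈ AddSubgroup.zmultiples (faithfulClass π) := by
    suffices (QuotientAddGroup.mk' (AddSubgroup.zmultiples (faithfulClass π))).comp e = 0 from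
      fun x => (QuotientAddGroup.eq_zero_iff _).1 (DFunLike.congr_fun this x)
    refine RQ.hom_ext fun V hV => (QuotientAddGroup.eq_zero_iff _).2 ?_
    obtain ⟨y, V', hV', hN, h⟩ := RQ.exists_eq_res_add hπ hker hz hcen V hV
    obtain ⟨k, hk⟩ := exists_mk_eq_smul hp hπ hker hz hcen hcard hlarge _ V' hV' hN rfl
    refine ⟨k, ?_⟩
    change k • faithfulClass π = e _
    rw [he, h, map_add, hret, RQ.ind_eq_zero hp.ne_zero hzπ V' hV' hN, add_zero,
      add_sub_cancel_left, hk]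
  have hpos : RQ.dim P (faithfulClass π) ≠ 0 := by
    rw [dim_faithfulClass, hcard]
    have h0 : 0 < Nat.card Q := Nat.card_pos
    have h1 := Nat.mul_le_mul_right (Nat.card Q) hp.two_le
    have : Nat.card Q < p * Nat.card Q := by omega
    rw [sub_ne_zero]
    exact_mod_cast this.ne'
  have hinj : ∀ k l : ℤ, k • faithfulClass π = l • faithfulClass π → k = l := fun k l h => by
    have := congrArg (RQ.dim P) h
    rw [map_zsmul, map_zsmul, smul_eq_mul, smul_eq_mul] at this
    exact mul_right_cancel₀ hpos this
  choose m hm using fun x => AddSubgroup.mem_zmultiples_iff.1 (hmem x)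
  refine ⟨AddMonoidHom.mk' m fun x y => hinj _ _ ?_, hinj _ _ ?_, fun y => hinj _ _ ?_, fun x => ?_⟩
  · rw [add_smul, hm, hm, hm, map_add]
  · change m _ • _ = _
    rw [hm, he, ind_faithfulClass hπ, map_zero, sub_zero, one_smul]
  · change m _ • _ = _
    rw [hm, he, hret, sub_self, zero_smul]
  · change x = _ + m x • _
    rw [hm, he, add_sub_cancel]

end Faithful

/-! ### The gluing problem -/

section NormalDestriction

open Subgroup Module

variable {G : Type u} [Group G]

/-- The projection `G → N_G(Z)/Z` for a normal subgroup `Z`, where `N_G(Z)` is `G` only up to the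
coercion from the top subgroup. -/
def toW (Z : Subgroup G) [hZ : Z.Normal] : G →* W Z :=
  (QuotientGroup.mk' _).comp ((MonoidHom.id G).codRestrict (normalizer (Z : Set G)) fun g => by
    rw [normalizer_eq_top]; exact mem_top g)

theorem toW_surjective (Z : Subgroup G) [Z.Normal] : Function.Surjective (toW Z) := by
  intro w
  obtain ⟨n, rfl⟩ := QuotientGroup.mk'_surjective _ w
  exact ⟨n, rfl⟩

theorem ker_toW (Z : Subgroup G) [Z.Normal] : (toW Z).ker = Z := by
  ext g
  exact (QuotientGroup.eq_one_iff _).trans Iff.rfl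

theorem map_comap_mk'_eq_comap_toW (Z : Subgroup G) [Z.Normal] (L : Subgroup (W Z)) :
    (L.comap (QuotientGroup.mk' _)).map (Subgroup.subtype _) = L.comap (toW Z) := by
  ext y
  constructor
  · rintro ⟨n, hn, rfl⟩
    exact hn
  · intro hy
    exact ⟨⟨y, by rw [normalizer_eq_top]; exact mem_top y⟩, hy, rfl⟩

theorem card_eq_card_mul_card_W (Z : Subgroup G) [Z.Normal] :
    Nat.card G = Nat.card Z * Nat.card (W Z) := by
  rw [← Z.card_mul_index, ← card_top (G := W Z), ← MonoidHom.range_eq_top.2 (toW_surjective Z),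
    ← index_ker, ker_toW]

variable [Finite G]

theorem des_of_normal (Z : Subgroup G) [Z.Normal] (f : RQDual G) :
    des Z f = f.comp (RQ.res (toW Z)) := by
  let ι := (normalizer (Z : Set G)).subtype
  let e : G →* normalizer (Z : Set G) := (MonoidHom.id G).codRestrict (normalizer (Z : Set G))
    fun g => by rw [normalizer_eq_top]; exact mem_top g
  have h₁ : (RQ.ind ι).comp (RQ.res ι) = AddMonoidHom.id _ :=
    RQ.ind_comp_res_of_surjective ι fun g => ⟨e g, rfl⟩
  have h₂ : (RQ.res ι).comp (RQ.res e) = AddMonoidHom.id _ := by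
    rw [RQ.res_comp]
    exact RQ.hom_ext fun V hV => RQ.res_mk _ V hV
  refine congrArg (AddMonoidHom.comp f) ?_
  rw [toW, ← RQ.res_comp, ← AddMonoidHom.id_comp ((RQ.res e).comp _), ← h₁,
    AddMonoidHom.comp_assoc, ← AddMonoidHom.comp_assoc _ (RQ.res e), h₂, AddMonoidHom.id_comp]

theorem resRel_injective_of_normal (Z K : Subgroup G) [Z.Normal] :
    Function.Injective (resRel Z K) := by
  have hsurj : Function.Surjective (inclRight Z K) := by
    intro w
    obtain ⟨n, rfl⟩ := QuotientGroup.mk'_surjective _ w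
    exact ⟨QuotientGroup.mk ⟨n, by rw [normalizer_eq_top]; exact mem_top _, n.2⟩, rfl⟩
  intro f g h
  have h := congrArg (fun k => AddMonoidHom.comp k (RQ.res (inclRight Z K))) h
  change (f.comp (RQ.ind _)).comp _ = (g.comp (RQ.ind _)).comp _ at h
  rwa [AddMonoidHom.comp_assoc, AddMonoidHom.comp_assoc, RQ.ind_comp_res_of_surjective _ hsurj] at h

/-- If a normal subgroup `Z` lies in all non-trivial subgroups, a gluing datum is determined by its
component at `Z`. -/
theorem eq_zero_of_mem_gluingData {Z : Subgroup G} [Z.Normal] (hZ : Z ≠ ⊥)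
    (hle : ∀ H : Subgroup G, H ≠ ⊥ → Z ≤ H)
    {x : ∀ H : {H : Subgroup G // H ≠ ⊥}, RQDual (W H.1)} (hx : x ∈ gluingData G)
    (h0 : x ⟨Z, hZ⟩ = 0) : x = 0 := by
  funext K
  have h := hx.2 ⟨Z, hZ⟩ K (hle K.1 K.2) inferInstance
  rw [h0, map_zero] at h
  exact resRel_injective_of_normal Z K.1 (h.symm.trans (map_zero _).symm)

end NormalDestriction

section RankOne

open Subgroup Module

variable {P : Type u} [Group P] [Finite P] {p : ℕ} [hp : Fact p.Prime] {Z : Subgroup P}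

theorem IsSocle.exists_generator (hP : IsPGroup p P) (hZ : IsSocle p Z) :
    ∃ (a : P) (m : ℕ), orderOf a = p ^ (m + 1) ∧ zpowers (a ^ p ^ m) = Z ∧
      (zpowers a = ⊤ ∨
        p = 2 ∧ (zpowers a).index = 2 ∧ ∀ g ∉ zpowers a, g ^ 2 = a ^ p ^ m) := by
  obtain ⟨a, hZa, hcase⟩ := hZ.exists_zpowers hP
  obtain ⟨n, hn⟩ := IsPGroup.iff_orderOf.1 hP a
  have hn0 : n ≠ 0 := by
    rintro rfl
    rw [pow_zero, orderOf_eq_one_iff] at hn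
    rw [hn, zpowers_one_eq_bot, le_bot_iff] at hZa
    exact hZ.ne_bot hZa
  obtain ⟨m, rfl⟩ := Nat.exists_eq_succ_of_ne_zero hn0
  have hz : orderOf (a ^ p ^ m) = p := by
    rw [orderOf_pow_of_dvd (pow_ne_zero _ hp.out.ne_zero) (hn ▸ pow_dvd_pow p (Nat.le_succ m)), hn,
      Nat.succ_eq_add_one, pow_succ, Nat.mul_div_cancel_left _ (pow_pos hp.out.pos m)]
  have hzZ : zpowers (a ^ p ^ m) = Z := by
    refine eq_of_le_of_card_ge (zpowers_le.2 (hZ.mem_of_pow_eq_one ?_)) ?_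
    · exact orderOf_dvd_iff_pow_eq_one.1 hz.dvd
    · rw [Nat.card_zpowers, hz, hZ.card_eq]
  refine ⟨a, m, hn, hzZ, hcase.imp_right ?_⟩
  rintro ⟨rfl, hidx, hsq⟩
  refine ⟨rfl, hidx, fun g hg => ?_⟩
  obtain ⟨h1, h2⟩ := hsq g hg
  classical
  rw [← hzZ, mem_zpowers_iff_mem_range_orderOf, hz] at h1
  obtain ⟨i, hi, hi'⟩ := Finset.mem_image.1 h1
  rw [Finset.mem_range] at hi
  interval_cases i
  · exact absurd hi'.symm (by simpa using h2)
  · rw [← hi', pow_one]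

theorem IsSocle.le_center (hP : IsPGroup p P) (hZ : IsSocle p Z) : Z ≤ center P := by
  refine hZ.le_of_ne_bot _ fun h => ?_
  have : Nontrivial P := by
    have := (nontrivial_iff_ne_bot Z).2 hZ.ne_bot
    exact Z.subtype_injective.nontrivial
  exact hP.bot_lt_center.ne' h

theorem IsSocle.exists_multiplicity (hP : IsPGroup p P) (hZ : IsSocle p Z) [Z.Normal] :
    ∃ m : RQ P →+ ℤ, m (faithfulClass (toW Z)) = 1 ∧ (∀ y, m (RQ.res (toW Z) y) = 0) ∧
      ∀ x, x = RQ.res (toW Z) (RQ.ind (toW Z) x) + m x • faithfulClass (toW Z) := by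
  obtain ⟨a, m, ha, hz, hcase⟩ := hZ.exists_generator hP
  refine exists_faithful_multiplicity (z := a ^ p ^ m) hp.out (toW_surjective Z)
    ((ker_toW Z).trans hz.symm) ?_ (hZ.le_center hP (hz ▸ mem_zpowers _)) ?_ ?_
  · rw [← pow_mul, ← pow_succ, ← ha, pow_orderOf_eq_one]
  · rw [card_eq_card_mul_card_W Z, hZ.card_eq]
  · intro V hV hN v hv
    exact card_le_finrank_span_orbit V.ρ ha hcase hN hv

theorem IsSocle.exact_gluingMap (hP : IsPGroup p P) (hZ : IsSocle p Z) :
    ∃ ι : ℤ →+ RQDual P, Function.Injective ι ∧ Function.Exact ι (gluingMap P) ∧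
      (gluingMap P).range = gluingData P := by
  have := hZ.normal
  obtain ⟨m, hms, hm0, hm⟩ := hZ.exists_multiplicity hP
  have hret : ∀ y, RQ.ind (toW Z) (RQ.res (toW Z) y) = y :=
    DFunLike.congr_fun (RQ.ind_comp_res_of_surjective _ (toW_surjective Z))
  have hι : ∀ c : ℤ, zmultiplesHom (RQDual P) m c = c • m := fun c => rfl
  refine ⟨zmultiplesHom _ m, fun c d h => ?_, fun f => ⟨fun h => ?_, ?_⟩, le_antisymm ?_ ?_⟩
  · have := DFunLike.congr_fun h (faithfulClass (toW Z))
    rwa [hι, hι, AddMonoidHom.zsmul_apply, AddMonoidHom.zsmul_apply, hms, smul_eq_mul, smul_eq_mul,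
      mul_one, mul_one] at this
  · have h0 : f.comp (RQ.res (toW Z)) = 0 := by
      rw [← des_of_normal]
      exact congrFun h ⟨Z, hZ.ne_bot⟩
    refine ⟨f (faithfulClass (toW Z)), AddMonoidHom.ext fun x => ?_⟩
    have h1 := congrArg f (hm x)
    have h2 := DFunLike.congr_fun h0 (RQ.ind (toW Z) x)
    rw [AddMonoidHom.comp_apply, AddMonoidHom.zero_apply] at h2
    rw [map_add, h2, zero_add, map_zsmul, smul_eq_mul, mul_comm] at h1
    rw [h1, hι, AddMonoidHom.zsmul_apply, smul_eq_mul]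
  · rintro ⟨c, rfl⟩
    refine eq_zero_of_mem_gluingData hZ.ne_bot hZ.le_of_ne_bot (gluingMap_mem_gluingData _) ?_
    change des Z _ = 0
    rw [des_of_normal, hι]
    ext y
    change c • m (RQ.res (toW Z) y) = 0
    rw [hm0, smul_zero]
  · rintro _ ⟨f, rfl⟩
    exact gluingMap_mem_gluingData f
  · intro x hx
    let f : RQDual P := (x ⟨Z, hZ.ne_bot⟩).comp (RQ.ind (toW Z))
    refine ⟨f, sub_eq_zero.1 (eq_zero_of_mem_gluingData hZ.ne_bot hZ.le_of_ne_bot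
      (sub_mem (gluingMap_mem_gluingData f) hx) ?_)⟩
    rw [Pi.sub_apply, sub_eq_zero]
    change des Z f = _
    rw [des_of_normal]
    exact AddMonoidHom.ext fun y => congrArg (x ⟨Z, hZ.ne_bot⟩) (hret y)

/-- If `ψ` linearizes `f` on `P/Z`, then `ψ(V_Z) + (f(1) - f(Z)) m(V)` linearizes `f` on `P`, where
`m` is the multiplicity of the faithful class. -/
theorem IsSocle.mem_range_linDual (hP : IsPGroup p P) (hZ : IsSocle p Z) (f : superClass P)
    (hf : superDes Z f ∈ (linDual (W Z)).range) : f ∈ (linDual P).range := by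
  have := hZ.normal
  obtain ⟨m, hms, hm0, -⟩ := hZ.exists_multiplicity hP
  have hret : ∀ y, RQ.ind (toW Z) (RQ.res (toW Z) y) = y :=
    DFunLike.congr_fun (RQ.ind_comp_res_of_surjective _ (toW_surjective Z))
  obtain ⟨ψ, hψ⟩ := hf
  have hval : ∀ L : Subgroup (W Z), ψ (permClass L) = f.1 (L.comap (toW Z)) := fun L => by
    rw [← map_comap_mk'_eq_comap_toW]
    exact congrFun (congrArg Subtype.val hψ) L
  refine ⟨ψ.comp (RQ.ind (toW Z)) + (f.1 ⊥ - f.1 Z) • m, Subtype.ext (funext fun H => ?_)⟩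
  change ψ (RQ.ind (toW Z) (permClass H)) + (f.1 ⊥ - f.1 Z) • m (permClass H) = f.1 H
  by_cases hH : H = ⊥
  · subst hH
    have h1 : permClass ⊥ = faithfulClass (toW Z) + RQ.res (toW Z) (permClass ⊥) := by
      rw [faithfulClass, sub_add_cancel]
    have h2 : m (permClass ⊥) = 1 := by rw [h1, map_add, hms, hm0, add_zero]
    rw [h2, RQ.ind_permClass, Subgroup.map_bot, hval, MonoidHom.comap_bot, ker_toW, smul_eq_mul]
    ring
  · have h1 : (H.map (toW Z)).comap (toW Z) = H :=
      comap_map_eq_self ((ker_toW Z).le.trans (hZ.le_of_ne_bot H hH))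
    have h2 : permClass H = RQ.res (toW Z) (permClass (H.map (toW Z))) := by
      rw [RQ.res_permClass _ (toW_surjective Z), h1]
    rw [h2, hm0, hret, hval, h1, smul_zero, add_zero]

end RankOne

section Cyclic

open Subgroup Module

theorem mk_eq_finrank_smul_of_subsingleton {P : Type u} [Group P] [Finite P] [Subsingleton P]
    (n : ℕ) :
    ∀ (V : Rep.{u} ℚ P) (hV : Module.Finite ℚ V), finrank ℚ V = n →
      RQ.mk V hV = n • permClass (⊥ : Subgroup P) := by
  have hP : ∀ (V : Rep.{u} ℚ P) (g : P), V.ρ g = 1 := fun V g => by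
    rw [Subsingleton.elim g 1, map_one]
  induction n with
  | zero =>
    intro V hV hn
    have : Subsingleton V := finrank_zero_iff.1 hn
    rw [RQ.mk_eq_zero, zero_smul]
  | succ n ih =>
    intro V hV hn
    have : Nontrivial V := nontrivial_of_finrank_pos (R := ℚ) (by omega)
    obtain ⟨v, hv⟩ := exists_ne (0 : V)
    have hW : ∀ g, Submodule.span ℚ {v} ≤ (Submodule.span ℚ {v}).comap (V.ρ g) := fun g => by
      rw [hP]; exact le_rfl
    have hfr := Submodule.finrank_quotient_add_finrank (Submodule.span ℚ {v})
    rw [finrank_span_singleton hv, hn] at hfr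
    have h1 : finrank ℚ (Submodule.span ℚ {v}) = finrank ℚ (MonoidAlgebra ℚ P) := by
      have := Fintype.ofFinite P
      rw [finrank_span_singleton hv, (MonoidAlgebra.coeffLinearEquiv ℚ).finrank_eq,
        finrank_finsupp_self, ← Nat.card_eq_fintype_card, Nat.card_unique]
    rw [RQ.mk_eq_add_quotient V hV _ hW,
      ih (V.quotient _ hW) _ (by exact Nat.add_right_cancel hfr), succ_nsmul',
      ← RQ.mk_leftRegular]
    congr 1
    let e : Submodule.span ℚ {v} ≃ₗ[ℚ] MonoidAlgebra ℚ P := LinearEquiv.ofFinrankEq _ _ h1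
    exact RQ.mk_eq_of_iso (V := V.subrepresentation _ hW) (W := Rep.leftRegular ℚ P)
      (Rep.mkIso (Representation.Equiv.mk e fun g => by
      rw [show V.ρ.subrepresentation _ hW g = 1 from hP (V.subrepresentation _ hW) g,
        show Representation.leftRegular ℚ P g = 1 from hP (Rep.leftRegular ℚ P) g]
      rfl)) _ _

theorem bijective_linDual_of_subsingleton {P : Type u} [Group P] [Finite P] [Subsingleton P] :
    Function.Bijective (linDual P) := by
  refine ⟨(injective_iff_map_eq_zero _).2 fun φ h => RQ.hom_ext fun V hV => ?_, fun f => ?_⟩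
  · have h : φ (permClass ⊥) = 0 := congrFun (congrArg Subtype.val h) ⊥
    rw [mk_eq_finrank_smul_of_subsingleton _ V hV rfl, map_nsmul, h, smul_zero,
      AddMonoidHom.zero_apply]
  · refine ⟨f.1 ⊥ • RQ.dim P, Subtype.ext (funext fun H => ?_)⟩
    rw [Subsingleton.elim H ⊥]
    change f.1 ⊥ • RQ.dim P (permClass ⊥) = _
    rw [RQ.dim_permClass, index_bot, Nat.card_unique, Nat.cast_one, smul_eq_mul, mul_one]

/-- Stated by induction on the order `n`, for all groups of that order. -/
theorem bijective_linDual_of_isCyclic {p : ℕ} [hp : Fact p.Prime] (n : ℕ) :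
    ∀ (P : Type u) [Group P] [Finite P] [IsCyclic P], IsPGroup p P → Nat.card P = n →
      Function.Bijective (linDual P) := by
  induction n using Nat.strong_induction_on with
  | _ n ih =>
    intro P _ _ _ hP hn
    rcases subsingleton_or_nontrivial P with hs | hs
    · exact bijective_linDual_of_subsingleton
    obtain ⟨Z, hZ⟩ := exists_isSocle_of_isCyclic hP
    have := hZ.normal
    have hcyc : IsCyclic (W Z) := isCyclic_of_surjective (toW Z) (toW_surjective Z)
    have hlt : Nat.card (W Z) < n := by
      have h1 := card_eq_card_mul_card_W Z
      rw [hZ.card_eq, hn] at h1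
      have h2 : 0 < Nat.card (W Z) := Nat.card_pos
      have h3 := Nat.mul_le_mul_right (Nat.card (W Z)) hp.out.two_le
      omega
    have hW := ih _ hlt (W Z) (hP.of_surjective (toW Z) (toW_surjective Z)) rfl
    refine ⟨(injective_iff_map_eq_zero _).2 fun φ h => ?_, fun f =>
      hZ.mem_range_linDual hP f (hW.2 _)⟩
    have h0 : des Z φ = 0 := hW.1 (by rw [← superDes_linDual, h, map_zero, map_zero])
    rw [des_of_normal] at h0
    have h1 : φ (permClass ⊥) = 0 := congrFun (congrArg Subtype.val h) ⊥
    have h2 : ∀ y, φ (RQ.res (toW Z) y) = 0 := DFunLike.congr_fun h0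
    obtain ⟨m, -, -, hm⟩ := hZ.exists_multiplicity hP
    refine AddMonoidHom.ext fun x => ?_
    rw [hm x, map_add, h2, map_zsmul, faithfulClass, map_sub, h1, h2, sub_zero, smul_zero, add_zero,
      AddMonoidHom.zero_apply]

end Cyclic

end RatGluing

theorem mainTheorem7 {p : ℕ} [Fact p.Prime] {P : Type u} [Group P] [Finite P]
    (hP : IsPGroup p P) (hrank : pRank p P = 1) :
    (∃ ι : ℤ →+ RQDual P, Function.Injective ι ∧ Function.Exact ι (gluingMap P) ∧
      (gluingMap P).range = gluingData P) ∧
    (∀ f : superClass P, f ∈ (linDual P).range ↔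
      ∀ Q : Subgroup P, Q ≠ ⊥ → superDes Q f ∈ (linDual (W Q)).range) ∧
    (IsCyclic P → Function.Bijective (linDual P) ∧
      ∀ Q : Subgroup P, Q ≠ ⊥ → Function.Bijective (linDual (W Q))) := by
  obtain ⟨Z, hZ⟩ := exists_isSocle_of_pRank_eq_one hP hrank
  refine ⟨hZ.exact_gluingMap hP, fun f => ⟨?_, fun h => ?_⟩, fun hc => ⟨?_, fun Q _ => ?_⟩⟩
  · rintro ⟨φ, rfl⟩ Q -
    exact ⟨des Q φ, (superDes_linDual Q φ).symm⟩
  · exact hZ.mem_range_linDual hP f (h Z hZ.ne_bot)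
  · exact bijective_linDual_of_isCyclic _ P hP rfl
  · have : IsCyclic (W Q) := isCyclic_of_surjective _ (QuotientGroup.mk'_surjective _)
    exact bijective_linDual_of_isCyclic _ (W Q) ((hP.to_subgroup _).to_quotient _) rfl
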